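/- Let $R$ be a commutative local ring (not necessarily noetherian) with maximal ideal $\mathfrak m$, and let $C$ be a semidualizing $R$-module: $C$ admits a resolution by finitely generated projective modules, the homothety map $R\to\operatorname{Hom}_R(C,C)$ is an isomorphism, and $\operatorname{Ext}_R^{n}(C,C)=0$ for all $n\ge 1$. An $R$-module $G$ is *$G_C$-projective* if $G\cong\operatorname{Coker}(P_1\to P_0)$ for some exact sequence $X=\cdots\to P_1\to P_0\to C\otimes_R Q^0\to C\otimes_R Q^1\to\cdots$ with all $P_i$, $Q^i$ projective such that $\operatorname{Hom}_R(X,C\otimes_R Q)$ is exact for every projective $R$-module $Q$. A *$G_C$-projective resolution* of an $R$-module $M$ is a complex $H=\cdots\to H_1\to H_0\to 0$ of $G_C$-projective modules with an augmentation $H_0\to M$ such that the augmented sequence $H^+=\cdots\to H_1\to H_0\to M\to 0$ is exact; it is *proper* if $\operatorname{Hom}_R(Y,H^+)$ is exact for every $G_C$-projective module $Y$. The $G_C$-projective dimension of $M$ is the infimum of $\sup\{n\mid H_n\neq 0\}$ over all $G_C$-projective resolutions $H$ of $M$. A complex $B$ is *minimal* if every homotopy equivalence $B\to B$ is an isomorphism.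 **Proposition.** Let $M$ be a finitely generated $R$-module of finite $G_C$-projective dimension such that $M$ and $\operatorname{Hom}_R(M,C)$ admit resolutions by finitely generated projective modules. For a $G_C$-projective resolution $H$ of $M$ consider the conditions 1. for every $n\ge 1$ there is an integer $\alpha_n\ge 0$ with $H_n\cong C^{\alpha_n}$; 2. $\partial^H_n(H_n)\subseteq\mathfrak m H_{n-1}$ for all $n\ge 2$; 3. $\partial^H_1(H_1)$ contains no nonzero $C$-summand of $H_0$, i.e. no direct summand of $H_0$ that is isomorphic to $C$. Then the following hold. (a) $M$ admits a minimal proper $G_C$-projective resolution. (b) A proper $G_C$-projective resolution $H$ of $M$ is minimal if and only if (1)–(3) hold. Moreover, every $G_C$-projective resolution $H$ of $M$ (proper or not) that satisfies (1)–(3) is minimal. -/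

import Mathlib

open CategoryTheory TensorProduct

universe u

namespace GCProj

variable {R : Type u} [CommRing R]

/-- A (left) resolution of `M` by modules in the class `𝒳`: a complex
`⋯ → X₂ → X₁ → X₀` of modules in `𝒳` with an augmentation `X₀ → M` such that the augmented
sequence `⋯ → X₂ → X₁ → X₀ → M → 0` is exact. -/
structure LeftResolution (𝒳 : ModuleCat.{u} R → Prop) (M : Type u) [AddCommGroup M]
    [Module R M] where
  complex : ChainComplex (ModuleCat.{u} R) ℕ
  mem : ∀ n, 𝒳 (complex.X n)
  aug : complex.X 0 →ₗ[R] M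
  aug_surjective : Function.Surjective aug
  exact_zero : Function.Exact (complex.d 1 0).hom aug
  exact_succ : ∀ n, Function.Exact (complex.d (n + 2) (n + 1)).hom (complex.d (n + 1) n).hom

/-- The `𝒳`-projective dimension of `M`: the infimum over all `𝒳`-resolutions `X` of `M` of
`sup {n | Xₙ ≠ 0}`; it is `⊤` if there is no bounded resolution and `⊥` if `M = 0` is
resolved by the zero complex. -/
noncomputable def projDim (𝒳 : ModuleCat.{u} R → Prop) (M : Type u) [AddCommGroup M]
    [Module R M] : WithBot ℕ∞ :=
  ⨅ X : LeftResolution 𝒳 M, ⨆ n : {n : ℕ // Nontrivial (X.complex.X n)},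
    (((n : ℕ) : ℕ∞) : WithBot ℕ∞)

/-- The resolution `X` is `𝒳`-proper: `Hom(Y, X⁺)` is exact for every `Y` in `𝒳`, where `X⁺` is
the augmented resolution. -/
def LeftResolution.IsProper {𝒳 : ModuleCat.{u} R → Prop} {M : Type u} [AddCommGroup M]
    [Module R M] (X : LeftResolution 𝒳 M) : Prop :=
  ∀ Y : ModuleCat.{u} R, 𝒳 Y →
    Function.Surjective (fun f : Y →ₗ[R] X.complex.X 0 => X.aug ∘ₗ f) ∧
    Function.Exact (fun f : Y →ₗ[R] X.complex.X 1 => (X.complex.d 1 0).hom ∘ₗ f)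
      (fun f : Y →ₗ[R] X.complex.X 0 => X.aug ∘ₗ f) ∧
    ∀ n, Function.Exact
      (fun f : Y →ₗ[R] X.complex.X (n + 2) => (X.complex.d (n + 2) (n + 1)).hom ∘ₗ f)
      (fun f : Y →ₗ[R] X.complex.X (n + 1) => (X.complex.d (n + 1) n).hom ∘ₗ f)

/-- A complex is minimal if each of its homotopy self-equivalences is an isomorphism. -/
def IsMinimal (B : ChainComplex (ModuleCat.{u} R) ℕ) : Prop :=
  ∀ f : HomotopyEquiv B B, IsIso f.hom

variable (R) in
/-- `M` admits a resolution by finitely generated projective modules. -/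
def HasFiniteProjectiveResolution (M : Type u) [AddCommGroup M] [Module R M] : Prop :=
  Nonempty (LeftResolution (R := R)
    (fun P => Module.Finite R P ∧ Module.Projective R P) M)

variable (R) in
/-- Semidualizing modules. -/
structure IsSemidualizing (C : Type u) [AddCommGroup C] [Module R C] : Prop where
  resolution : HasFiniteProjectiveResolution R C
  homothety : Function.Bijective (LinearMap.lsmul R C : R →ₗ[R] (C →ₗ[R] C))
  ext_eq_zero : ∀ n : ℕ, 1 ≤ n →
    Subsingleton (Abelian.Ext (ModuleCat.of R C) (ModuleCat.of R C) n)

variable (R) in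
/-- A complete `PC`-resolution: an exact sequence
`⋯ → X₁ → X₀ → X₋₁ → X₋₂ → ⋯` with `Xᵢ` projective for `i ≥ 0` and `Xᵢ ≅ C ⊗ Q` with `Q`
projective for `i < 0`, which stays exact under `Hom(-, C ⊗ Q)` for every projective `Q`. -/
structure IsCompletePCResolution (C : Type u) [AddCommGroup C] [Module R C]
    (X : ChainComplex (ModuleCat.{u} R) ℤ) : Prop where
  projective : ∀ i : ℤ, 0 ≤ i → Module.Projective R (X.X i)
  cProjective : ∀ i : ℤ, i < 0 → ∃ Q : ModuleCat.{u} R, Module.Projective R Q ∧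
    Nonempty (X.X i ≃ₗ[R] C ⊗[R] Q)
  exact : ∀ i : ℤ, Function.Exact (X.d (i + 1) i).hom (X.d i (i - 1)).hom
  hom_exact : ∀ Q : ModuleCat.{u} R, Module.Projective R Q → ∀ i : ℤ,
    Function.Exact
      (fun f : X.X (i - 1) →ₗ[R] C ⊗[R] Q => f ∘ₗ (X.d i (i - 1)).hom)
      (fun f : X.X i →ₗ[R] C ⊗[R] Q => f ∘ₗ (X.d (i + 1) i).hom)

/-- `M` is `G_C`-projective: `M ≅ Coker (X₁ → X₀)` for a complete `PC`-resolution `X`. -/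
def IsGCProjective (C : Type u) [AddCommGroup C] [Module R C] (M : ModuleCat.{u} R) : Prop :=
  ∃ X : ChainComplex (ModuleCat.{u} R) ℤ, IsCompletePCResolution R C X ∧
    Nonempty (M ≃ₗ[R] (X.X 0 ⧸ LinearMap.range (X.d 1 0).hom))

variable (R) in
/-- `G_C`-projective resolutions of `M`. -/
abbrev GCResolution (C : Type u) [AddCommGroup C] [Module R C] (M : Type u) [AddCommGroup M]
    [Module R M] :=
  LeftResolution (R := R) (IsGCProjective C) M

variable (R) in
/-- The `G_C`-projective dimension of `M`. -/
noncomputable abbrev gcProjDim (C : Type u) [AddCommGroup C] [Module R C] (M : Type u)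
    [AddCommGroup M] [Module R M] : WithBot ℕ∞ :=
  projDim (R := R) (IsGCProjective C) M

/-- The submodule `S` of `H` contains a direct summand of `H` that is isomorphic to `C`. -/
def ContainsCSummand (C : Type u) [AddCommGroup C] [Module R C] {H : Type u} [AddCommGroup H]
    [Module R H] (S : Submodule R H) : Prop :=
  ∃ N : Submodule R H, N ≤ S ∧ Nonempty (N ≃ₗ[R] C) ∧ ∃ N' : Submodule R H, IsCompl N N'

/-- The three conditions on a complex `H`: `Hₙ ≅ C^α` with `α` finite for `n ≥ 1`;
`∂ₙ(Hₙ) ⊆ 𝔪 Hₙ₋₁` for `n ≥ 2`; and `∂₁(H₁)` contains no (nonzero) `C`-summand of `H₀`. -/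
structure MinimalityConditions [IsLocalRing R] (C : Type u) [AddCommGroup C] [Module R C]
    (H : ChainComplex (ModuleCat.{u} R) ℕ) : Prop where
  free : ∀ n, 1 ≤ n → ∃ α : ℕ, Nonempty (H.X n ≃ₗ[R] (Fin α → C))
  range_le : ∀ n, 2 ≤ n → LinearMap.range (H.d n (n - 1)).hom ≤
    IsLocalRing.maximalIdeal R • (⊤ : Submodule R (H.X (n - 1)))
  no_summand : ¬ ContainsCSummand C (LinearMap.range (H.d 1 0).hom)

end GCProj

/-! Existence. `isGCProjective_iff` identifies the G_C-projective modules with `GCClass`, which is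
closed under extensions, kernels of surjections and retracts, and contains the finite free modules.
An Auslander–Buchweitz induction (`exists_approximation`) then gives `0 → K → G → M → 0` with `G`
G_C-projective and `K` finitely resolved by powers of `C`. Since `Ext^{≥1}(Y, K) = 0` for every
G_C-projective `Y`, and likewise for the later syzygies, splicing yields a proper resolution.
Because `End C = R` is local and `𝔪C ≠ C`, a map `Cᵃ → C` either has image in `𝔪C` or is surjective
with kernel `Cᵃ⁻¹`. So using as few copies of `C` as possible at each stage forces conditions
(1)–(3).

Minimality. If `e` is homotopic to the identity of a resolution satisfying (1)–(3), then `e - 1 = sd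
+ ds` has image in `𝔪Hₙ` for `n ≥ 1`. Nakayama makes `e` bijective there, and exactness settles
degree 0. Properness is not needed.

Converse. Proper resolutions of `M` are homotopy equivalent, so minimal ones are isomorphic. Any
minimal proper resolution is therefore isomorphic to the one constructed, and (1)–(3) are invariant
under isomorphism. -/

namespace GCProj

/-! ### Vanishing of Ext along short exact sequences. -/

section ExtTools

variable {R : Type u} [CommRing R]

/-- `0 → A → B → D → 0` is exact. -/
structure ShortExactSeq {A B D : Type u} [AddCommGroup A] [AddCommGroup B] [AddCommGroup D]
    [Module R A] [Module R B] [Module R D] (f : A →ₗ[R] B) (g : B →ₗ[R] D) : Prop where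
  inj : Function.Injective f
  exact : Function.Exact f g
  surj : Function.Surjective g

variable (R) in
/-- `Extⁿ(A, T) = 0`. -/
def ExtVanish (n : ℕ) (A T : Type u) [AddCommGroup A] [AddCommGroup T] [Module R A]
    [Module R T] : Prop :=
  Subsingleton (Abelian.Ext (ModuleCat.of R A) (ModuleCat.of R T) n)

variable {A B D T S : Type u} [AddCommGroup A] [AddCommGroup B] [AddCommGroup D]
  [AddCommGroup T] [AddCommGroup S] [Module R A] [Module R B] [Module R D] [Module R T]
  [Module R S] {f : A →ₗ[R] B} {g : B →ₗ[R] D}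

namespace ShortExactSeq

theorem comp_eq_zero (h : ShortExactSeq f g) : g ∘ₗ f = 0 := h.exact.linearMap_comp_eq_zero

/-- The short complex of a short exact sequence of modules. -/
abbrev shortComplex (h : ShortExactSeq f g) : ShortComplex (ModuleCat.{u} R) :=
  ShortComplex.mk (ModuleCat.ofHom f) (ModuleCat.ofHom g)
    (by rw [← ModuleCat.ofHom_comp, h.comp_eq_zero]; rfl)

theorem shortExact (h : ShortExactSeq f g) : h.shortComplex.ShortExact :=
  ModuleCat.shortComplex_shortExact _ h.exact h.inj h.surj

theorem ker {p : B →ₗ[R] D} (hp : Function.Surjective p) :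
    ShortExactSeq (LinearMap.ker p).subtype p :=
  ⟨Subtype.val_injective, LinearMap.exact_subtype_ker_map p, hp⟩

theorem range {i : A →ₗ[R] B} (hi : Function.Injective i) :
    ShortExactSeq i (LinearMap.range i).mkQ :=
  ⟨hi, LinearMap.exact_map_mkQ_range i, Submodule.mkQ_surjective _⟩

theorem extVanish_middle (h : ShortExactSeq f g) {n : ℕ} (hA : ExtVanish R n A T)
    (hD : ExtVanish R n D T) : ExtVanish R n B T := by
  unfold ExtVanish at *
  refine subsingleton_of_forall_eq 0 fun x => ?_
  obtain ⟨y, rfl⟩ := Abelian.Ext.contravariant_sequence_exact₂ h.shortExact _ x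
    (Subsingleton.elim (α := Abelian.Ext (ModuleCat.of R A) (ModuleCat.of R T) n) _ _)
  have : y = 0 := Subsingleton.elim (α := Abelian.Ext (ModuleCat.of R D) (ModuleCat.of R T) n) _ _
  rw [this, Abelian.Ext.comp_zero]

theorem extVanish_left (h : ShortExactSeq f g) {n : ℕ} (hB : ExtVanish R n B T)
    (hD : ExtVanish R (n + 1) D T) : ExtVanish R n A T := by
  unfold ExtVanish at *
  refine subsingleton_of_forall_eq 0 fun x => ?_
  obtain ⟨y, rfl⟩ := Abelian.Ext.contravariant_sequence_exact₁ h.shortExact _ x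
    (Nat.add_comm 1 n)
    (Subsingleton.elim (α := Abelian.Ext (ModuleCat.of R D) (ModuleCat.of R T) (n + 1)) _ _)
  have : y = 0 := Subsingleton.elim (α := Abelian.Ext (ModuleCat.of R B) (ModuleCat.of R T) n) _ _
  rw [this, Abelian.Ext.comp_zero]

theorem extVanish_right (h : ShortExactSeq f g) {n : ℕ} (hA : ExtVanish R n A T)
    (hB : ExtVanish R (n + 1) B T) : ExtVanish R (n + 1) D T := by
  unfold ExtVanish at *
  refine subsingleton_of_forall_eq 0 fun x => ?_
  obtain ⟨y, rfl⟩ := Abelian.Ext.contravariant_sequence_exact₃ h.shortExact _ x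
    (Subsingleton.elim (α := Abelian.Ext (ModuleCat.of R B) (ModuleCat.of R T) (n + 1)) _ _)
    (Nat.add_comm 1 n)
  have : y = 0 := Subsingleton.elim (α := Abelian.Ext (ModuleCat.of R A) (ModuleCat.of R T) n) _ _
  rw [this, Abelian.Ext.comp_zero]

theorem extVanish_cov_right (h : ShortExactSeq f g) {n : ℕ} (hB : ExtVanish R n T B)
    (hA : ExtVanish R (n + 1) T A) : ExtVanish R n T D := by
  unfold ExtVanish at *
  refine subsingleton_of_forall_eq 0 fun x => ?_
  obtain ⟨y, rfl⟩ := Abelian.Ext.covariant_sequence_exact₃ _ h.shortExact x rfl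
    (Subsingleton.elim (α := Abelian.Ext (ModuleCat.of R T) (ModuleCat.of R A) (n + 1)) _ _)
  have : y = 0 := Subsingleton.elim (α := Abelian.Ext (ModuleCat.of R T) (ModuleCat.of R B) n) _ _
  rw [this, Abelian.Ext.zero_comp]

theorem exists_extension (h : ShortExactSeq f g) (hD : ExtVanish R 1 D T) (φ : A →ₗ[R] T) :
    ∃ ψ : B →ₗ[R] T, ψ ∘ₗ f = φ := by
  unfold ExtVanish at *
  obtain ⟨y, hy⟩ := Abelian.Ext.contravariant_sequence_exact₁ h.shortExact _
    (Abelian.Ext.mk₀ (ModuleCat.ofHom φ)) (n₁ := 1) rfl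
    (Subsingleton.elim (α := Abelian.Ext (ModuleCat.of R D) (ModuleCat.of R T) 1) _ _)
  obtain ⟨ψ, rfl⟩ := (Abelian.Ext.mk₀_bijective _ _).2 y
  rw [Abelian.Ext.mk₀_comp_mk₀] at hy
  refine ⟨ψ.hom, ?_⟩
  have := (Abelian.Ext.mk₀_bijective _ _).1 hy
  exact congrArg ModuleCat.Hom.hom this

/-- As `Ext¹(B, T) = 0`, every class in `Ext¹(D, T)` is the connecting image of a map `A → T`, and
this image is zero once the map extends to `B`. Vanishing in degree one thus becomes an extension
problem. -/
theorem extVanish_one (h : ShortExactSeq f g) (hB : ExtVanish R 1 B T)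
    (hext : ∀ φ : A →ₗ[R] T, ∃ ψ : B →ₗ[R] T, ψ ∘ₗ f = φ) : ExtVanish R 1 D T := by
  unfold ExtVanish at *
  refine subsingleton_of_forall_eq 0 fun x => ?_
  obtain ⟨y, rfl⟩ := Abelian.Ext.contravariant_sequence_exact₃ h.shortExact _ x
    (Subsingleton.elim (α := Abelian.Ext (ModuleCat.of R B) (ModuleCat.of R T) 1) _ _)
    (n₀ := 0) rfl
  obtain ⟨φ, rfl⟩ := (Abelian.Ext.mk₀_bijective _ _).2 y
  obtain ⟨ψ, hψ⟩ := hext φ.hom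
  have : φ = ModuleCat.ofHom f ≫ ModuleCat.ofHom ψ := by
    ext x; exact (LinearMap.congr_fun hψ x).symm
  rw [this, ← Abelian.Ext.mk₀_comp_mk₀]
  exact ShortComplex.ShortExact.extClass_comp_assoc h.shortExact _

theorem exists_lift (h : ShortExactSeq f g) (hA : ExtVanish R 1 T A) (φ : T →ₗ[R] D) :
    ∃ ψ : T →ₗ[R] B, g ∘ₗ ψ = φ := by
  unfold ExtVanish at *
  obtain ⟨y, hy⟩ := Abelian.Ext.covariant_sequence_exact₃ _ h.shortExact
    (Abelian.Ext.mk₀ (ModuleCat.ofHom φ)) (n₁ := 1) rfl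
    (Subsingleton.elim (α := Abelian.Ext (ModuleCat.of R T) (ModuleCat.of R A) 1) _ _)
  obtain ⟨ψ, rfl⟩ := (Abelian.Ext.mk₀_bijective _ _).2 y
  rw [Abelian.Ext.mk₀_comp_mk₀] at hy
  refine ⟨ψ.hom, ?_⟩
  have := (Abelian.Ext.mk₀_bijective _ _).1 hy
  exact congrArg ModuleCat.Hom.hom this

end ShortExactSeq

theorem extVanish_of_projective [Module.Projective R A] (n : ℕ) : ExtVanish R (n + 1) A T := by
  unfold ExtVanish
  have : Projective (ModuleCat.of R A) := (IsProjective.iff_projective A).1 inferInstance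
  exact Abelian.Ext.subsingleton_of_projective _ _ _

theorem ExtVanish.retract {n : ℕ} (h : ExtVanish R n B T) (i : A →ₗ[R] B) (r : B →ₗ[R] A)
    (hri : r ∘ₗ i = LinearMap.id) : ExtVanish R n A T := by
  unfold ExtVanish at *
  refine subsingleton_of_forall_eq 0 fun x => ?_
  rw [← Abelian.Ext.mk₀_id_comp x]
  have : 𝟙 (ModuleCat.of R A) = ModuleCat.ofHom i ≫ ModuleCat.ofHom r := by
    rw [← ModuleCat.ofHom_comp, hri]; rfl
  rw [this, ← Abelian.Ext.mk₀_comp_mk₀_assoc,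
    Subsingleton.elim ((Abelian.Ext.mk₀ (ModuleCat.ofHom r)).comp x (zero_add n)) 0,
    Abelian.Ext.comp_zero]

theorem ExtVanish.retract_right {n : ℕ} (h : ExtVanish R n T B) (i : A →ₗ[R] B) (r : B →ₗ[R] A)
    (hri : r ∘ₗ i = LinearMap.id) : ExtVanish R n T A := by
  unfold ExtVanish at *
  refine subsingleton_of_forall_eq 0 fun x => ?_
  rw [← Abelian.Ext.comp_mk₀_id x]
  have : 𝟙 (ModuleCat.of R A) = ModuleCat.ofHom i ≫ ModuleCat.ofHom r := by
    rw [← ModuleCat.ofHom_comp, hri]; rfl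
  rw [this, ← Abelian.Ext.mk₀_comp_mk₀, ← Abelian.Ext.comp_assoc_of_second_deg_zero,
    Subsingleton.elim (x.comp (Abelian.Ext.mk₀ (ModuleCat.ofHom i)) (add_zero n)) 0,
    Abelian.Ext.zero_comp]

theorem extVanish_of_subsingleton [Subsingleton T] (n : ℕ) : ExtVanish R n A T := by
  unfold ExtVanish
  refine subsingleton_of_forall_eq 0 fun x => ?_
  rw [← Abelian.Ext.comp_mk₀_id x]
  have : 𝟙 (ModuleCat.of R T) = 0 := by ext; exact Subsingleton.elim _ _
  rw [this, Abelian.Ext.mk₀_zero, Abelian.Ext.comp_zero]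

end ExtTools

/-! ### Sequences of cokernels, and maps into `C ⊗ Q` with `Q` projective. -/

section ModuleTools

variable {R : Type u} [CommRing R]

theorem ShortExactSeq.exists_factor {A B D T : Type u} [AddCommGroup A] [AddCommGroup B]
    [AddCommGroup D] [AddCommGroup T] [Module R A] [Module R B] [Module R D] [Module R T]
    {f : A →ₗ[R] B} {g : B →ₗ[R] D} (h : ShortExactSeq f g) (φ : B →ₗ[R] T)
    (hφ : φ ∘ₗ f = 0) : ∃ ψ : D →ₗ[R] T, ψ ∘ₗ g = φ := by
  have hker : LinearMap.ker g ≤ LinearMap.ker φ := fun x hx => by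
    obtain ⟨a, rfl⟩ := (h.exact x).1 hx
    exact LinearMap.congr_fun hφ a
  refine ⟨((LinearMap.ker g).liftQ φ hker) ∘ₗ (g.quotKerEquivOfSurjective h.surj).symm, ?_⟩
  ext x
  have : (g.quotKerEquivOfSurjective h.surj).symm (g x) = (LinearMap.ker g).mkQ x := by
    rw [LinearEquiv.symm_apply_eq]; rfl
  simp only [LinearMap.comp_apply, LinearEquiv.coe_coe, this, Submodule.mkQ_apply,
    Submodule.liftQ_apply]

/-- The cokernels of a morphism of short exact sequences with injective components form a short
exact sequence. -/
theorem ShortExactSeq.coker_seq {A B D A₁ B₁ D₁ NA NB ND : Type u} [AddCommGroup A]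
    [AddCommGroup B] [AddCommGroup D] [AddCommGroup A₁] [AddCommGroup B₁] [AddCommGroup D₁]
    [AddCommGroup NA] [AddCommGroup NB] [AddCommGroup ND] [Module R A] [Module R B] [Module R D]
    [Module R A₁] [Module R B₁] [Module R D₁] [Module R NA] [Module R NB] [Module R ND]
    {f : A →ₗ[R] B} {g : B →ₗ[R] D} (h : ShortExactSeq f g)
    {f₁ : A₁ →ₗ[R] B₁} {g₁ : B₁ →ₗ[R] D₁} (h₁ : ShortExactSeq f₁ g₁)
    {a : A →ₗ[R] A₁} {a' : A₁ →ₗ[R] NA} (ha : ShortExactSeq a a')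
    {b : B →ₗ[R] B₁} {b' : B₁ →ₗ[R] NB} (hb : ShortExactSeq b b')
    {d : D →ₗ[R] D₁} {d' : D₁ →ₗ[R] ND} (hd : ShortExactSeq d d')
    (hab : ∀ x, b (f x) = f₁ (a x)) (hbd : ∀ x, g₁ (b x) = d (g x)) :
    ∃ (v : NA →ₗ[R] NB) (w : NB →ₗ[R] ND), ShortExactSeq v w := by
  obtain ⟨v, hv⟩ := ha.exists_factor (b' ∘ₗ f₁) (by
    ext x; simp [← hab, hb.exact.apply_apply_eq_zero])
  obtain ⟨w, hw⟩ := hb.exists_factor (d' ∘ₗ g₁) (by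
    ext x; simp [hbd, hd.exact.apply_apply_eq_zero])
  replace hv : ∀ x, v (a' x) = b' (f₁ x) := LinearMap.congr_fun hv
  replace hw : ∀ x, w (b' x) = d' (g₁ x) := LinearMap.congr_fun hw
  refine ⟨v, w, (injective_iff_map_eq_zero v).2 fun y hy => ?_, fun y => ⟨fun hy => ?_, ?_⟩,
    fun y => ?_⟩
  · obtain ⟨x, rfl⟩ := ha.surj y
    rw [hv] at hy
    obtain ⟨z, hz⟩ := (hb.exact _).1 hy
    have : g z = 0 := hd.inj (by rw [← hbd, hz, h₁.exact.apply_apply_eq_zero, map_zero])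
    obtain ⟨t, rfl⟩ := (h.exact _).1 this
    rw [hab] at hz
    rw [← h₁.inj hz, ha.exact.apply_apply_eq_zero]
  · obtain ⟨x, rfl⟩ := hb.surj y
    rw [hw] at hy
    obtain ⟨z, hz⟩ := (hd.exact _).1 hy
    obtain ⟨t, rfl⟩ := h.surj z
    have : g₁ (x - b t) = 0 := by rw [map_sub, hbd, hz, sub_self]
    obtain ⟨s, hs⟩ := (h₁.exact _).1 this
    exact ⟨a' s, by rw [hv, hs, map_sub, hb.exact.apply_apply_eq_zero, sub_zero]⟩
  · rintro ⟨z, rfl⟩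
    obtain ⟨x, rfl⟩ := ha.surj z
    rw [hv, hw, h₁.exact.apply_apply_eq_zero, map_zero]
  · obtain ⟨x, rfl⟩ := hd.surj y
    obtain ⟨z, rfl⟩ := h₁.surj x
    exact ⟨b' z, hw z⟩

/-- `0 → B/A → E/A → E/B → 0` for `A ⊆ B ⊆ E`. -/
theorem ShortExactSeq.comp_coker_seq {A B D E N N' : Type u} [AddCommGroup A] [AddCommGroup B]
    [AddCommGroup D] [AddCommGroup E] [AddCommGroup N] [AddCommGroup N'] [Module R A]
    [Module R B] [Module R D] [Module R E] [Module R N] [Module R N']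
    {f : A →ₗ[R] B} {g : B →ₗ[R] D} (h : ShortExactSeq f g)
    {i : B →ₗ[R] E} {p : E →ₗ[R] N} (hi : ShortExactSeq i p)
    {k : E →ₗ[R] N'} (hk : ShortExactSeq (i ∘ₗ f) k) :
    ∃ (v : D →ₗ[R] N') (w : N' →ₗ[R] N), ShortExactSeq v w := by
  obtain ⟨v, hv⟩ := h.exists_factor (k ∘ₗ i) hk.comp_eq_zero
  obtain ⟨w, hw⟩ := hk.exists_factor p (by
    rw [← LinearMap.comp_assoc, hi.comp_eq_zero, LinearMap.zero_comp])
  replace hv : ∀ x, v (g x) = k (i x) := LinearMap.congr_fun hv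
  replace hw : ∀ x, w (k x) = p x := LinearMap.congr_fun hw
  refine ⟨v, w, (injective_iff_map_eq_zero v).2 fun y hy => ?_, fun y => ⟨fun hy => ?_, ?_⟩,
    fun y => ?_⟩
  · obtain ⟨x, rfl⟩ := h.surj y
    rw [hv] at hy
    obtain ⟨z, hz⟩ := (hk.exact _).1 hy
    rw [← hi.inj hz, h.exact.apply_apply_eq_zero]
  · obtain ⟨x, rfl⟩ := hk.surj y
    rw [hw] at hy
    obtain ⟨z, rfl⟩ := (hi.exact _).1 hy
    exact ⟨g z, hv z⟩
  · rintro ⟨z, rfl⟩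
    obtain ⟨x, rfl⟩ := h.surj z
    rw [hv, hw, hi.exact.apply_apply_eq_zero]
  · obtain ⟨x, rfl⟩ := hi.surj y
    exact ⟨k x, hw x⟩

theorem exists_projective_cover (N : Type u) [AddCommGroup N] [Module R N] :
    ∃ (P : ModuleCat.{u} R) (p : P →ₗ[R] N), Module.Projective R P ∧ Function.Surjective p :=
  ⟨ModuleCat.of R (N →₀ R), Finsupp.linearCombination R id,
    inferInstanceAs (Module.Projective R (N →₀ R)), Finsupp.linearCombination_id_surjective R N⟩

/-- Dimension shifting reduces to degree one. There a map `K ⊗ Q → T` is a map `Q → Hom(K, T)`,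
which lifts along the surjective restriction `Hom(P, T) → Hom(K, T)` because `Q` is projective. -/
theorem ExtVanish.tensor {T : Type u} [AddCommGroup T] [Module R T] (Q : Type u) [AddCommGroup Q]
    [Module R Q] [Module.Projective R Q] (n : ℕ) : ∀ {N : Type u} [AddCommGroup N] [Module R N],
    ExtVanish R (n + 1) N T → ExtVanish R (n + 1) (N ⊗[R] Q) T := by
  induction n with
  | zero =>
    intro N _ _ h
    obtain ⟨P, p, hP, hp⟩ := exists_projective_cover (R := R) N
    have hs := ShortExactSeq.ker hp
    have hs' : ShortExactSeq ((LinearMap.ker p).subtype.rTensor Q) (p.rTensor Q) :=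
      ⟨Module.Flat.rTensor_preserves_injective_linearMap _ hs.inj,
        rTensor_exact Q hs.exact hs.surj, LinearMap.rTensor_surjective Q hp⟩
    refine hs'.extVanish_one (extVanish_of_projective 0) fun φ => ?_
    obtain ⟨ψ, hψ⟩ := Module.projective_lifting_property
      (LinearMap.lcomp R T (LinearMap.ker p).subtype) (TensorProduct.curry φ).flip
      (fun θ => hs.exists_extension h θ)
    refine ⟨TensorProduct.lift ψ.flip, TensorProduct.ext' fun x q => ?_⟩
    have := LinearMap.congr_fun (LinearMap.congr_fun hψ q) x
    simpa using this
  | succ n ih =>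
    intro N _ _ h
    obtain ⟨P, p, hP, hp⟩ := exists_projective_cover (R := R) N
    have hs := ShortExactSeq.ker hp
    have hs' : ShortExactSeq ((LinearMap.ker p).subtype.rTensor Q) (p.rTensor Q) :=
      ⟨Module.Flat.rTensor_preserves_injective_linearMap _ hs.inj,
        rTensor_exact Q hs.exact hs.surj, LinearMap.rTensor_surjective Q hp⟩
    exact hs'.extVanish_right (ih (hs.extVanish_left (extVanish_of_projective n) h))
      (extVanish_of_projective _)

/-- A map from a finitely generated module to `C ⊗ Q` with `Q` projective is fixed by an
endomorphism that factors through a finite power of `C`. -/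
theorem exists_factor_finite_power (C Q : Type u) [AddCommGroup C] [AddCommGroup Q] [Module R C]
    [Module R Q] [Module.Projective R Q] {K : Type u} [AddCommGroup K] [Module R K]
    [Module.Finite R K] (f : K →ₗ[R] C ⊗[R] Q) :
    ∃ (a : ℕ) (g : C ⊗[R] Q →ₗ[R] (Fin a → C)) (h : (Fin a → C) →ₗ[R] C ⊗[R] Q),
      ∀ k, h (g (f k)) = f k := by
  classical
  -- The section `s` of `Q →₀ R → Q` makes `C ⊗ Q` a retract of the direct sum `Q →₀ C`, with
  -- inclusion `e` and retraction `Φ`.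
  obtain ⟨s, hs⟩ := Module.projective_def'.1 ‹Module.Projective R Q›
  let e : C ⊗[R] Q →ₗ[R] (Q →₀ C) :=
    (TensorProduct.finsuppScalarRight R R C Q).toLinearMap ∘ₗ s.lTensor C
  let Φ : (Q →₀ C) →ₗ[R] C ⊗[R] Q :=
    Finsupp.lsum R fun q => (TensorProduct.mk R C Q).flip q
  have hΦ : Φ ∘ₗ e = LinearMap.id := by
    refine TensorProduct.ext' fun c q => ?_
    have key : ∀ y : Q →₀ R, Φ (TensorProduct.finsuppScalarRight R R C Q (c ⊗ₜ y)) =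
        c ⊗ₜ[R] Finsupp.linearCombination R id y := by
      intro y
      induction y using Finsupp.induction_linear with
      | zero => simp
      | add y z hy hz => rw [TensorProduct.tmul_add, map_add, map_add, hy, hz, map_add,
          TensorProduct.tmul_add]
      | single x r => simp [Φ, TensorProduct.finsuppScalarRight_apply_tmul]
    simp only [e, LinearMap.comp_apply, LinearMap.lTensor_tmul, LinearEquiv.coe_coe, key,
      LinearMap.id_apply]
    congr 1
    exact LinearMap.congr_fun hs q
  -- Finite generation of `K` confines the image of `e ∘ f` to finitely many summands.
  obtain ⟨S, hS⟩ : ∃ S : Finset Q, ∀ k, (e (f k)).support ⊆ S := by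
    obtain ⟨G, hG⟩ := Module.Finite.fg_top (R := R) (M := K)
    refine ⟨G.biUnion fun k => (e (f k)).support, fun k => ?_⟩
    have hk : k ∈ Submodule.span R (G : Set K) := hG ▸ Submodule.mem_top
    induction hk using Submodule.span_induction with
    | mem x hx => exact Finset.subset_biUnion_of_mem (fun k => (e (f k)).support) hx
    | zero => simp
    | add x y _ _ hx hy =>
      rw [map_add, map_add]
      exact Finsupp.support_add.trans (Finset.union_subset hx hy)
    | smul r x _ hx =>
      rw [map_smul, map_smul]
      exact Finsupp.support_smul.trans hx
  let q : Fin S.card ≃ S := S.equivFin.symm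
  refine ⟨S.card, LinearMap.pi fun i => Finsupp.lapply (q i : Q) ∘ₗ e,
    ∑ i, (TensorProduct.mk R C Q).flip (q i) ∘ₗ LinearMap.proj i, fun k => ?_⟩
  have h1 : Φ (e (f k)) = f k := LinearMap.congr_fun hΦ _
  conv_rhs => rw [← h1]
  have h2 : Φ (e (f k)) = ∑ x ∈ S, e (f k) x ⊗ₜ[R] x :=
    Finsupp.sum_of_support_subset _ (hS k) _ (by simp)
  rw [h2, ← Finset.sum_coe_sort S, ← q.sum_comp]
  simp [LinearMap.sum_apply]

end ModuleTools

/-! ### Modules with no higher Ext into `C ⊗ Q`. -/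

section Perp

variable (R : Type u) [CommRing R] (C : Type u) [AddCommGroup C] [Module R C]

/-- `Extⁿ(N, C ⊗ Q) = 0` for all projective modules `Q` and all `n ≥ 1`. -/
def Perp (N : Type u) [AddCommGroup N] [Module R N] : Prop :=
  ∀ (Q : Type u) [AddCommGroup Q] [Module R Q], Module.Projective R Q → ∀ n : ℕ,
    ExtVanish R (n + 1) N (C ⊗[R] Q)

variable {R C} {N A B D : Type u} [AddCommGroup N] [Module R N] [AddCommGroup A] [AddCommGroup B]
  [AddCommGroup D] [Module R A] [Module R B] [Module R D] {f : A →ₗ[R] B} {g : B →ₗ[R] D}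

theorem perp_of_projective [Module.Projective R N] : Perp R C N :=
  fun _ _ _ _ n => extVanish_of_projective n

theorem Perp.retract (h : Perp R C B) (i : A →ₗ[R] B) (r : B →ₗ[R] A)
    (hri : r ∘ₗ i = LinearMap.id) : Perp R C A :=
  fun Q _ _ hQ n => (h Q hQ n).retract i r hri

theorem Perp.equiv (h : Perp R C B) (e : A ≃ₗ[R] B) : Perp R C A :=
  h.retract e.toLinearMap e.symm.toLinearMap (by ext; simp)

theorem Perp.tensor (h : Perp R C N) (Q : Type u) [AddCommGroup Q] [Module R Q]
    [Module.Projective R Q] : Perp R C (N ⊗[R] Q) :=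
  fun Q' _ _ hQ' n => (h Q' hQ' n).tensor Q n

theorem ShortExactSeq.perp_middle (h : ShortExactSeq f g) (hA : Perp R C A) (hD : Perp R C D) :
    Perp R C B :=
  fun Q _ _ hQ n => h.extVanish_middle (hA Q hQ n) (hD Q hQ n)

theorem ShortExactSeq.perp_left (h : ShortExactSeq f g) (hB : Perp R C B) (hD : Perp R C D) :
    Perp R C A :=
  fun Q _ _ hQ n => h.extVanish_left (hB Q hQ n) (hD Q hQ (n + 1))

/-- The equivalence `Cⁿ ≃ C ⊗ Rⁿ`. -/
noncomputable def powEquivTensor (C : Type u) [AddCommGroup C] [Module R C] (n : ℕ) :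
    (Fin n → C) ≃ₗ[R] C ⊗[R] (Fin n → R) :=
  (TensorProduct.piScalarRight R R C (Fin n)).symm

theorem Perp.extVanish_pow (h : Perp R C N) (a n : ℕ) : ExtVanish R (n + 1) N (Fin a → C) :=
  (h (Fin a → R) inferInstance n).retract_right (powEquivTensor C a).toLinearMap
    (powEquivTensor C a).symm.toLinearMap (by ext; simp)

theorem Perp.extVanish_self (h : Perp R C N) (n : ℕ) : ExtVanish R (n + 1) N C :=
  (h.extVanish_pow 1 n).retract_right (LinearMap.pi fun _ => LinearMap.id) (LinearMap.proj 0)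
    (by ext; simp)

end Perp

/-! ### A coinductive description of G_C-projective modules and its closure properties. -/

section GCClass

variable (R : Type u) [CommRing R] (C : Type u) [AddCommGroup C] [Module R C]

/-- The largest class of modules `N` with `Ext^{≥1}(N, C ⊗ Q) = 0` for all projective `Q` each of
which embeds in a module `C ⊗ Q`, `Q` projective, with cokernel again in the class. -/
def GCClass (N : Type u) [AddCommGroup N] [Module R N] : Prop :=
  ∃ 𝒮 : ModuleCat.{u} R → Prop, 𝒮 (ModuleCat.of R N) ∧ ∀ X : ModuleCat.{u} R, 𝒮 X →
    Perp R C X ∧ ∃ (Q N' : ModuleCat.{u} R) (f : X →ₗ[R] C ⊗[R] Q) (g : C ⊗[R] Q →ₗ[R] N'),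
      Module.Projective R Q ∧ ShortExactSeq f g ∧ 𝒮 N'

variable {R C} {N A B D : Type u} [AddCommGroup N] [Module R N] [AddCommGroup A] [AddCommGroup B]
  [AddCommGroup D] [Module R A] [Module R B] [Module R D] {f : A →ₗ[R] B} {g : B →ₗ[R] D}

theorem GCClass.perp (h : GCClass R C N) : Perp R C N := by
  obtain ⟨𝒮, hN, h𝒮⟩ := h
  exact (h𝒮 _ hN).1

theorem GCClass.exists_coresolution (h : GCClass R C N) :
    ∃ (Q N' : ModuleCat.{u} R) (f : N →ₗ[R] C ⊗[R] Q) (g : C ⊗[R] Q →ₗ[R] N'),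
      Module.Projective R Q ∧ ShortExactSeq f g ∧ GCClass R C N' := by
  obtain ⟨𝒮, hN, h𝒮⟩ := h
  obtain ⟨Q, N', f, g, hQ, hs, hN'⟩ := (h𝒮 _ hN).2
  exact ⟨Q, N', f, g, hQ, hs, 𝒮, hN', h𝒮⟩

/-- The modules in `Perp` with one such embedding whose cokernel is in `GCClass` form a family
containing `GCClass`, hence a valid witness. -/
theorem GCClass.of_embedding (hN : Perp R C N) {Q N' : Type u} [AddCommGroup Q] [Module R Q]
    [AddCommGroup N'] [Module R N'] {f : N →ₗ[R] C ⊗[R] Q} {g : C ⊗[R] Q →ₗ[R] N'}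
    (hQ : Module.Projective R Q) (hs : ShortExactSeq f g) (hN' : GCClass R C N') :
    GCClass R C N := by
  refine ⟨fun X => Perp R C X ∧ ∃ (Q N' : ModuleCat.{u} R) (f : X →ₗ[R] C ⊗[R] Q)
    (g : C ⊗[R] Q →ₗ[R] N'), Module.Projective R Q ∧ ShortExactSeq f g ∧ GCClass R C N',
    ⟨hN, ModuleCat.of R Q, ModuleCat.of R N', f, g, hQ, hs, hN'⟩, fun X hX => ⟨hX.1, ?_⟩⟩
  obtain ⟨-, Q, N', f, g, hQ, hs, hN'⟩ := hX
  exact ⟨Q, N', f, g, hQ, hs, hN'.perp, hN'.exists_coresolution⟩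

/-- Horseshoe argument: `A → C ⊗ Q₁` extends to the middle term because `Ext¹(D, C ⊗ Q₁) = 0`, and
together with `D → C ⊗ Q₂` it embeds that term in `C ⊗ (Q₁ × Q₂)`. The cokernel is again an
extension, so the family of all extensions is a witness. -/
theorem ShortExactSeq.gcClass_middle (h : ShortExactSeq f g) (hA : GCClass R C A)
    (hD : GCClass R C D) : GCClass R C B := by
  refine ⟨fun X => ∃ (A D : ModuleCat.{u} R) (f : A →ₗ[R] X) (g : X →ₗ[R] D),
    ShortExactSeq f g ∧ GCClass R C A ∧ GCClass R C D,
    ⟨ModuleCat.of R A, ModuleCat.of R D, f, g, h, hA, hD⟩, ?_⟩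
  rintro X ⟨A, D, f, g, h, hA, hD⟩
  refine ⟨h.perp_middle hA.perp hD.perp, ?_⟩
  obtain ⟨Q₁, N₁, a, a', hQ₁, ha, hN₁⟩ := hA.exists_coresolution
  obtain ⟨Q₂, N₂, d, d', hQ₂, hd, hN₂⟩ := hD.exists_coresolution
  obtain ⟨ψ, hψ⟩ := h.exists_extension (hD.perp Q₁ hQ₁ 0) a
  let e := TensorProduct.prodRight R R C Q₁ Q₂
  let F : X →ₗ[R] C ⊗[R] (Q₁ × Q₂) := e.symm.toLinearMap ∘ₗ ψ.prod (d ∘ₗ g)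
  have hrow : ShortExactSeq (e.symm.toLinearMap ∘ₗ LinearMap.inl R (C ⊗[R] Q₁) (C ⊗[R] Q₂))
      (LinearMap.snd R (C ⊗[R] Q₁) (C ⊗[R] Q₂) ∘ₗ e.toLinearMap) := by
    refine ⟨e.symm.injective.comp LinearMap.inl_injective, fun y => ?_,
      fun y => ⟨e.symm (0, y), by simp⟩⟩
    obtain ⟨y, rfl⟩ := e.symm.surjective y
    simp only [LinearMap.comp_apply, LinearEquiv.coe_coe, LinearEquiv.apply_symm_apply,
      Set.mem_range, EmbeddingLike.apply_eq_iff_eq]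
    exact ⟨fun h => ⟨y.1, Prod.ext rfl h.symm⟩, by rintro ⟨z, rfl⟩; rfl⟩
  have hF : Function.Injective F := by
    refine (injective_iff_map_eq_zero F).2 fun x hx => ?_
    have hx' : (ψ x, d (g x)) = 0 := e.symm.injective (by simpa [F] using hx)
    have h2 : g x = 0 := hd.inj (by rw [map_zero]; exact congrArg Prod.snd hx')
    obtain ⟨y, rfl⟩ := (h.exact x).1 h2
    have h1 : a y = 0 := by rw [← hψ]; exact congrArg Prod.fst hx'
    rw [ha.inj (h1.trans (map_zero a).symm), map_zero]
  obtain ⟨v, w, hvw⟩ := h.coker_seq hrow ha (ShortExactSeq.range hF) hd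
    (fun x => by
      simp [F, ← hψ, h.exact.apply_apply_eq_zero])
    (fun x => by simp [F])
  exact ⟨ModuleCat.of R (Q₁ × Q₂), ModuleCat.of R (C ⊗[R] (Q₁ × Q₂) ⧸ LinearMap.range F), F, _,
    inferInstanceAs (Module.Projective R (Q₁ × Q₂)), ShortExactSeq.range hF, N₁, N₂, v, w, hvw,
    hN₁, hN₂⟩

theorem GCClass.prod (hA : GCClass R C A) (hB : GCClass R C B) : GCClass R C (A × B) :=
  ShortExactSeq.gcClass_middle (f := LinearMap.inl R A B) (g := LinearMap.snd R A B)
    ⟨LinearMap.inl_injective, Function.Exact.inl_snd, LinearMap.snd_surjective⟩ hA hB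

/-- Embed `B` in `C ⊗ Q` with cokernel `N` in the class. The cokernel of `A → B → C ⊗ Q` is an
extension of `N` by `D`. -/
theorem ShortExactSeq.gcClass_left (h : ShortExactSeq f g) (hB : GCClass R C B)
    (hD : GCClass R C D) : GCClass R C A := by
  obtain ⟨Q, N, i, p, hQ, hi, hN⟩ := hB.exists_coresolution
  have hk := ShortExactSeq.range (show Function.Injective (i ∘ₗ f) from hi.inj.comp h.inj)
  obtain ⟨v, w, hvw⟩ := h.comp_coker_seq hi hk
  exact GCClass.of_embedding (h.perp_left hB.perp hD.perp) hQ hk (hvw.gcClass_middle hD hN)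

/-- The family of all retracts is a witness: if `A` is embedded in `C ⊗ Q` through `B`, the cokernel
is again a retract of a module in the class. -/
theorem GCClass.retract (h : GCClass R C B) (i : A →ₗ[R] B) (r : B →ₗ[R] A)
    (hri : r ∘ₗ i = LinearMap.id) : GCClass R C A := by
  refine ⟨fun A => ∃ (B : ModuleCat.{u} R) (i : A →ₗ[R] B) (r : B →ₗ[R] A),
    GCClass R C B ∧ r ∘ₗ i = LinearMap.id, ⟨ModuleCat.of R B, i, r, h, hri⟩, ?_⟩
  rintro A ⟨B, i, r, hB, hri⟩
  refine ⟨hB.perp.retract i r hri, ?_⟩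
  replace hri : ∀ x, r (i x) = x := LinearMap.congr_fun hri
  obtain ⟨Q, N, j, p, hQ, hj, hN⟩ := hB.exists_coresolution
  have hk := ShortExactSeq.range (show Function.Injective (j ∘ₗ i) from
    hj.inj.comp (Function.LeftInverse.injective hri))
  set k := (LinearMap.range (j ∘ₗ i)).mkQ
  obtain ⟨v, hv⟩ := hk.exists_factor p (by
    rw [← LinearMap.comp_assoc, hj.comp_eq_zero, LinearMap.zero_comp])
  replace hv : ∀ x, v (k x) = p x := LinearMap.congr_fun hv
  have hki : ∀ a, k (j (i a)) = 0 := hk.exact.apply_apply_eq_zero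
  -- The exact sequence `0 → B → (C ⊗ Q)/A × A → N → 0` puts the product, of which `(C ⊗ Q)/A` is a
  -- factor, in the class.
  have hs : ShortExactSeq ((k ∘ₗ j).prod r) (v ∘ₗ LinearMap.fst R _ A) := by
    refine ⟨(injective_iff_map_eq_zero _).2 fun x hx => ?_, fun y => ⟨fun hy => ?_, ?_⟩,
      fun y => ?_⟩
    · have h1 : k (j x) = 0 := congrArg Prod.fst hx
      have h2 : r x = 0 := congrArg Prod.snd hx
      obtain ⟨a, ha⟩ := (hk.exact _).1 h1
      rw [← hj.inj ha, hri] at h2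
      rw [← hj.inj ha, h2, map_zero]
    · obtain ⟨y, a⟩ := y
      obtain ⟨c, rfl⟩ := hk.surj y
      replace hy : v (k c) = 0 := hy
      rw [hv] at hy
      obtain ⟨x, rfl⟩ := (hj.exact c).1 hy
      exact ⟨x - i (r x) + i a, by simp [hki, hri]⟩
    · rintro ⟨x, rfl⟩
      simp [hv, hj.exact.apply_apply_eq_zero]
    · obtain ⟨c, rfl⟩ := hj.surj y
      exact ⟨(k c, 0), hv c⟩
  exact ⟨Q, ModuleCat.of R (C ⊗[R] Q ⧸ LinearMap.range (j ∘ₗ i)), j ∘ₗ i, k, hQ, hk,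
    ModuleCat.of R ((C ⊗[R] Q ⧸ LinearMap.range (j ∘ₗ i)) × A),
    LinearMap.inl R _ _, LinearMap.fst R _ _, hs.gcClass_middle hB hN, by ext; rfl⟩

theorem GCClass.equiv (h : GCClass R C B) (e : A ≃ₗ[R] B) : GCClass R C A :=
  h.retract e.toLinearMap e.symm.toLinearMap (by ext; simp)

theorem gcClass_tensor (hC : Perp R C C) (Q : Type u) [AddCommGroup Q] [Module R Q]
    [Module.Projective R Q] : GCClass R C (C ⊗[R] Q) := by
  refine ⟨fun X => ∃ Q : ModuleCat.{u} R, Module.Projective R Q ∧ Nonempty (X ≃ₗ[R] C ⊗[R] Q),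
    ⟨ModuleCat.of R Q, inferInstanceAs (Module.Projective R Q), ⟨LinearEquiv.refl R _⟩⟩, ?_⟩
  rintro X ⟨Q, hQ, ⟨e⟩⟩
  -- Each member embeds by an isomorphism; the zero cokernel is written `C ⊗ PUnit` to stay in the
  -- family.
  have : Subsingleton (C ⊗[R] PUnit.{u + 1}) :=
    ⟨fun x y => by
      have h : ∀ z : C ⊗[R] PUnit.{u + 1}, z = 0 := fun z => by
        induction z with
        | zero => rfl
        | tmul c q => rw [Subsingleton.elim q 0, TensorProduct.tmul_zero]
        | add x y hx hy => rw [hx, hy, add_zero]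
      rw [h x, h y]⟩
  refine ⟨(hC.tensor Q).equiv e, Q, ModuleCat.of R (C ⊗[R] PUnit.{u + 1}), e.toLinearMap, 0, hQ,
    ⟨e.injective, fun y => ?_, fun y => ⟨0, Subsingleton.elim (α := C ⊗[R] PUnit.{u + 1}) _ _⟩⟩,
    ModuleCat.of R PUnit.{u + 1}, inferInstanceAs (Module.Projective R PUnit.{u + 1}),
    ⟨LinearEquiv.refl R _⟩⟩
  simp

theorem gcClass_pow (hC : Perp R C C) (a : ℕ) : GCClass R C (Fin a → C) :=
  (gcClass_tensor hC (Fin a → R)).equiv (powEquivTensor C a)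

theorem gcClass_self (hC : Perp R C C) : GCClass R C C :=
  (gcClass_pow hC 1).retract (LinearMap.pi fun _ => LinearMap.id) (LinearMap.proj 0)
    (by ext; simp)

/-- A finitely generated module in `GCClass` embeds in a finite power of `C` with cokernel in
`GCClass`. -/
theorem GCClass.exists_finite_coresolution (hC : Perp R C C) [Module.Finite R N]
    (hN : GCClass R C N) : ∃ (a : ℕ) (N' : ModuleCat.{u} R) (f : N →ₗ[R] (Fin a → C))
      (g : (Fin a → C) →ₗ[R] N'), ShortExactSeq f g ∧ GCClass R C N' := by
  obtain ⟨Q, N₁, f, p, hQ, hf, hN₁⟩ := hN.exists_coresolution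
  obtain ⟨a, g, h, hgh⟩ := exists_factor_finite_power C Q f
  have hgf : Function.Injective (g ∘ₗ f) := fun x y hxy =>
    hf.inj (by rw [← hgh x, ← hgh y]; exact congrArg h hxy)
  have hk := ShortExactSeq.range hgf
  refine ⟨a, ModuleCat.of R ((Fin a → C) ⧸ LinearMap.range (g ∘ₗ f)), g ∘ₗ f, _, hk, ?_⟩
  set k := (LinearMap.range (g ∘ₗ f)).mkQ
  -- The new cokernel is a retract of `N₁ × Cᵃ`: the composite of `i` and `(q, k)` is the identity
  -- because `q ∘ p = k ∘ g`.
  obtain ⟨i, hi⟩ := hk.exists_factor ((p ∘ₗ h).prod (LinearMap.id - g ∘ₗ h)) (by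
    ext x : 1
    simp [hgh, hf.exact.apply_apply_eq_zero])
  obtain ⟨q, hq⟩ := hf.exists_factor (k ∘ₗ g) (by
    ext x; exact hk.exact.apply_apply_eq_zero x)
  refine (hN₁.prod (gcClass_pow hC a)).retract i (q.coprod k) ?_
  replace hi : ∀ x, i (k x) = (p (h x), x - g (h x)) := LinearMap.congr_fun hi
  replace hq : ∀ x, q (p x) = k (g x) := LinearMap.congr_fun hq
  refine LinearMap.ext fun y => ?_
  obtain ⟨x, rfl⟩ := hk.surj y
  rw [LinearMap.comp_apply, hi, LinearMap.coprod_apply, hq, ← map_add, add_sub_cancel]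
  rfl

end GCClass

/-! ### Finite free resolutions, `C`-duality, and finite free modules as G_C-projectives. -/

section FiniteResolution

variable {R : Type u} [CommRing R] {A B : Type u} [AddCommGroup A] [AddCommGroup B]
  [Module R A] [Module R B]

/-- Transport of a resolution along an isomorphism. -/
def LeftResolution.ofEquiv {𝒳 : ModuleCat.{u} R → Prop} (X : LeftResolution 𝒳 A)
    (e : A ≃ₗ[R] B) : LeftResolution 𝒳 B where
  complex := X.complex
  mem := X.mem
  aug := e.toLinearMap ∘ₗ X.aug
  aug_surjective := e.surjective.comp X.aug_surjective
  exact_zero := fun x => by simpa using X.exact_zero x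
  exact_succ := X.exact_succ

/-- The resolution of the kernel of the augmentation of a resolution. -/
noncomputable def LeftResolution.syzygy {𝒳 : ModuleCat.{u} R → Prop} (X : LeftResolution 𝒳 A) :
    LeftResolution 𝒳 (LinearMap.ker X.aug) where
  complex := ChainComplex.truncate.obj X.complex
  mem n := X.mem (n + 1)
  aug := (X.complex.d 1 0).hom.codRestrict _ fun x => X.exact_zero.apply_apply_eq_zero x
  aug_surjective := fun y => by
    obtain ⟨x, hx⟩ := (X.exact_zero y).1 y.2
    exact ⟨x, Subtype.ext hx⟩
  exact_zero := fun x => by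
    rw [Subtype.ext_iff]
    exact X.exact_succ 0 x
  exact_succ n := X.exact_succ (n + 1)

theorem HasFiniteProjectiveResolution.equiv (h : HasFiniteProjectiveResolution R A)
    (e : A ≃ₗ[R] B) : HasFiniteProjectiveResolution R B :=
  h.map fun X => X.ofEquiv e

theorem HasFiniteProjectiveResolution.finite (h : HasFiniteProjectiveResolution R A) :
    Module.Finite R A := by
  obtain ⟨X⟩ := h
  have := (X.mem 0).1
  exact Module.Finite.of_surjective X.aug X.aug_surjective

theorem HasFiniteProjectiveResolution.exists_free_cover [IsLocalRing R]
    (h : HasFiniteProjectiveResolution R A) : ∃ (n : ℕ) (p : (Fin n → R) →ₗ[R] A),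
      Function.Surjective p ∧ HasFiniteProjectiveResolution R (LinearMap.ker p) := by
  obtain ⟨X⟩ := h
  obtain ⟨_, _⟩ := X.mem 0
  have : Module.Free R (X.complex.X 0) := Module.free_of_flat_of_isLocalRing
  let e := (Module.finBasis R (X.complex.X 0)).equivFun.symm
  refine ⟨_, X.aug ∘ₗ e.toLinearMap, X.aug_surjective.comp e.surjective, ?_⟩
  exact HasFiniteProjectiveResolution.equiv ⟨X.syzygy⟩ (e.ofSubmodule' (LinearMap.ker X.aug)).symm

variable {C : Type u} [AddCommGroup C] [Module R C]

/-- Maps from a finitely generated submodule to modules `C ⊗ Q` extend if those to `C` do. -/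
theorem exists_extension_tensor {K P : Type u} [AddCommGroup K] [Module R K] [AddCommGroup P]
    [Module R P] [Module.Finite R K] (i : K →ₗ[R] P)
    (hi : ∀ φ : K →ₗ[R] C, ∃ ψ : P →ₗ[R] C, ψ ∘ₗ i = φ) (Q : Type u) [AddCommGroup Q]
    [Module R Q] [Module.Projective R Q] (φ : K →ₗ[R] C ⊗[R] Q) :
    ∃ ψ : P →ₗ[R] C ⊗[R] Q, ψ ∘ₗ i = φ := by
  obtain ⟨a, g, h, hgh⟩ := exists_factor_finite_power C Q φ
  choose ψ hψ using fun j : Fin a => hi (LinearMap.proj j ∘ₗ g ∘ₗ φ)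
  refine ⟨h ∘ₗ LinearMap.pi ψ, LinearMap.ext fun k => ?_⟩
  rw [← hgh]
  simp only [LinearMap.comp_apply]
  congr 1
  exact funext fun j => LinearMap.congr_fun (hψ j) k

/-- Testing against `C` is enough: all syzygies are finitely generated, so a map from one to `C ⊗ Q`
factors through a finite power of `C` and extends coordinatewise. -/
theorem HasFiniteProjectiveResolution.perp [IsLocalRing R]
    (hA : HasFiniteProjectiveResolution R A) (hext : ∀ n, ExtVanish R (n + 1) A C) :
    Perp R C A := by
  intro Q _ _ hQ n
  induction n generalizing A with
  | zero =>
    obtain ⟨m, p, hp, hK⟩ := hA.exists_free_cover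
    have := hK.finite
    exact (ShortExactSeq.ker hp).extVanish_one (extVanish_of_projective 0)
      (exists_extension_tensor _ ((ShortExactSeq.ker hp).exists_extension (hext 0)) Q)
  | succ n ih =>
    obtain ⟨m, p, hp, hK⟩ := hA.exists_free_cover
    exact (ShortExactSeq.ker hp).extVanish_right
      (ih hK fun k => (ShortExactSeq.ker hp).extVanish_left (extVanish_of_projective k)
        (hext (k + 1))) (extVanish_of_projective _)

theorem IsSemidualizing.perp [IsLocalRing R] (hC : IsSemidualizing R C) : Perp R C C :=
  hC.resolution.perp fun n => hC.ext_eq_zero (n + 1) (Nat.le_add_left 1 n)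

theorem IsSemidualizing.exists_smul (hC : IsSemidualizing R C) (φ : C →ₗ[R] C) :
    ∃ r : R, ∀ c, φ c = r • c := by
  obtain ⟨r, rfl⟩ := hC.homothety.2 φ
  exact ⟨r, fun c => rfl⟩

theorem IsSemidualizing.eq_of_smul_eq (hC : IsSemidualizing R C) {r s : R}
    (h : ∀ c : C, r • c = s • c) : r = s :=
  hC.homothety.1 (LinearMap.ext h)

variable (R C) in
/-- The class of the `C`-duals `Hom(Ω, C)` of modules `Ω` with a finite free resolution,
`Ext^{≥1}(Ω, C) = 0` and bijective biduality map. -/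
def IsCDual (X : ModuleCat.{u} R) : Prop :=
  Module.Finite R X ∧ Perp R C X ∧ ∃ Ω : ModuleCat.{u} R, HasFiniteProjectiveResolution R Ω ∧
    (∀ n, ExtVanish R (n + 1) Ω C) ∧
    Function.Bijective (LinearMap.id.flip : Ω →ₗ[R] (Ω →ₗ[R] C) →ₗ[R] C) ∧
    Nonempty (X ≃ₗ[R] (Ω →ₗ[R] C))

/-- `Cⁿ ≃ Hom(Rⁿ, C)`. -/
noncomputable def powEquivHom (C : Type u) [AddCommGroup C] [Module R C] (n : ℕ) :
    (Fin n → C) ≃ₗ[R] ((Fin n → R) →ₗ[R] C) :=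
  (Pi.basisFun R (Fin n)).constr R

theorem powEquivHom_apply (n : ℕ) (c : Fin n → C) (x : Fin n → R) :
    powEquivHom C n c x = ∑ i, x i • c i := by
  simp [powEquivHom, Module.Basis.constr_apply_fintype]

theorem IsSemidualizing.bidual_free (hC : IsSemidualizing R C) (n : ℕ) :
    Function.Bijective
      (LinearMap.id.flip : (Fin n → R) →ₗ[R] ((Fin n → R) →ₗ[R] C) →ₗ[R] C) := by
  classical
  constructor
  · intro x y hxy
    refine funext fun i => hC.eq_of_smul_eq fun c => ?_
    have := LinearMap.congr_fun hxy (powEquivHom C n (Pi.single i c))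
    simpa [powEquivHom_apply, Pi.single_apply] using this
  · intro θ
    choose x hx using fun i => hC.exists_smul
      (θ ∘ₗ (powEquivHom C n).toLinearMap ∘ₗ LinearMap.single R (fun _ => C) i)
    refine ⟨x, LinearMap.ext fun φ => ?_⟩
    obtain ⟨c, rfl⟩ := (powEquivHom C n).surjective φ
    have h1 : c = ∑ i, Pi.single i (c i) := (Finset.univ_sum_single c).symm
    have h2 : θ (powEquivHom C n c) = ∑ i, θ (powEquivHom C n (Pi.single i (c i))) := by
      conv_lhs => rw [h1, map_sum, map_sum]
    rw [h2]
    simp only [LinearMap.flip_apply, LinearMap.id_apply, powEquivHom_apply]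
    exact Finset.sum_congr rfl fun i _ => (hx i (c i)).symm

/-- Dualizing `0 → ker p → Rⁿ → Ω → 0` into `C` stays exact because `Ext¹(Ω, C) = 0`. The cokernel
is the dual of `ker p`, which inherits the conditions on `Ω`. -/
theorem IsCDual.exists_coresolution [IsLocalRing R] (hC : IsSemidualizing R C)
    {X : ModuleCat.{u} R} (hX : IsCDual R C X) :
    ∃ (Q N' : ModuleCat.{u} R) (f : X →ₗ[R] C ⊗[R] Q) (g : C ⊗[R] Q →ₗ[R] N'),
      Module.Projective R Q ∧ ShortExactSeq f g ∧ IsCDual R C N' := by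
  obtain ⟨hfin, hperp, Ω, hΩ, hext, hbi, ⟨e⟩⟩ := hX
  obtain ⟨n, p, hp, hK⟩ := hΩ.exists_free_cover
  have hs := ShortExactSeq.ker hp
  let E : ((Fin n → R) →ₗ[R] C) ≃ₗ[R] C ⊗[R] (Fin n → R) :=
    (powEquivHom C n).symm.trans (powEquivTensor C n)
  let f : X →ₗ[R] ((Fin n → R) →ₗ[R] C) := LinearMap.lcomp R C p ∘ₗ e.toLinearMap
  let g : ((Fin n → R) →ₗ[R] C) →ₗ[R] (LinearMap.ker p →ₗ[R] C) :=
    LinearMap.lcomp R C (LinearMap.ker p).subtype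
  have hfg : ShortExactSeq f g := by
    refine ⟨fun x y hxy => e.injective (LinearMap.ext fun w => ?_), fun φ => ⟨fun hφ => ?_, ?_⟩,
      fun φ => hs.exists_extension (hext 0) φ⟩
    · obtain ⟨z, rfl⟩ := hp w
      exact LinearMap.congr_fun hxy z
    · obtain ⟨ψ, hψ⟩ := hs.exists_factor φ hφ
      exact ⟨e.symm ψ, (congrArg (LinearMap.lcomp R C p) (e.apply_symm_apply ψ)).trans hψ⟩
    · rintro ⟨x, rfl⟩
      ext z
      change e x (p z) = 0
      rw [z.2, map_zero]
  have hfinF : Module.Finite R ((Fin n → R) →ₗ[R] C) :=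
    have := hC.resolution.finite
    Module.Finite.equiv (powEquivHom C n)
  have hperpF : Perp R C ((Fin n → R) →ₗ[R] C) := (hC.perp.tensor (Fin n → R)).equiv E
  have hperpN : Perp R C (LinearMap.ker p →ₗ[R] C) := by
    intro Q _ _ hQ k
    cases k with
    | zero =>
      refine hfg.extVanish_one (hperpF Q hQ 0) (exists_extension_tensor f (fun φ => ?_) Q)
      -- By biduality `φ` is evaluation at some `ω = p z`, and evaluation at `z` extends it to the
      -- dual of `Rⁿ`.
      obtain ⟨ω, hω⟩ := hbi.2 (φ ∘ₗ e.symm.toLinearMap)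
      obtain ⟨z, rfl⟩ := hp ω
      refine ⟨LinearMap.id.flip z, LinearMap.ext fun x => ?_⟩
      have := LinearMap.congr_fun hω (e x)
      simpa [f] using this
    | succ k => exact hfg.extVanish_right (hperp Q hQ k) (hperpF Q hQ (k + 1))
  refine ⟨ModuleCat.of R (Fin n → R), ModuleCat.of R (LinearMap.ker p →ₗ[R] C),
    E.toLinearMap ∘ₗ f, g ∘ₗ E.symm.toLinearMap, inferInstanceAs (Module.Projective R (Fin n → R)),
    ⟨E.injective.comp hfg.inj, fun y => ?_, hfg.surj.comp E.symm.surjective⟩,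
    Module.Finite.of_surjective g hfg.surj, hperpN, ModuleCat.of R (LinearMap.ker p), hK,
    fun k => hs.extVanish_left (extVanish_of_projective k) (hext (k + 1)), ⟨?_, fun θ => ?_⟩,
    ⟨LinearEquiv.refl R _⟩⟩
  · obtain ⟨y, rfl⟩ := E.surjective y
    simpa using hfg.exact y
  · intro x y hxy
    refine Subtype.ext ((hC.bidual_free n).1 (LinearMap.ext fun φ => ?_))
    exact LinearMap.congr_fun hxy (g φ)
  -- `θ ∘ g` is evaluation at some `z`. It kills the dual of `Ω`, so `p z = 0` by injectivity of
  -- biduality for `Ω`.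
  · obtain ⟨z, hz⟩ := (hC.bidual_free n).2 (θ ∘ₗ g)
    replace hz : ∀ φ, φ z = θ (g φ) := LinearMap.congr_fun hz
    have hpz : p z = 0 := hbi.1 (LinearMap.ext fun ψ => by
      have h1 := hz (f (e.symm ψ))
      rw [hfg.exact.apply_apply_eq_zero, map_zero] at h1
      simpa [f] using h1)
    refine ⟨⟨z, hpz⟩, LinearMap.ext fun φ => ?_⟩
    obtain ⟨ψ, rfl⟩ := hfg.surj φ
    exact hz ψ

/-- By homothety `R ≅ Hom(C, C)` is the dual of `Ω = C`, and the biduality map of `C` is inverted by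
evaluation at the identity. -/
theorem IsSemidualizing.gcClass_ring [IsLocalRing R] (hC : IsSemidualizing R C) :
    GCClass R C R := by
  refine ⟨IsCDual R C, ⟨inferInstanceAs (Module.Finite R R), perp_of_projective,
    ModuleCat.of R C, hC.resolution, hC.perp.extVanish_self, ⟨fun x y hxy => ?_, fun θ => ?_⟩,
    ⟨LinearEquiv.ofBijective _ hC.homothety⟩⟩,
    fun X hX => ⟨hX.2.1, hX.exists_coresolution hC⟩⟩
  · exact LinearMap.congr_fun hxy LinearMap.id
  · refine ⟨θ LinearMap.id, LinearMap.ext fun φ => ?_⟩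
    obtain ⟨r, rfl⟩ := hC.homothety.2 φ
    change r • θ LinearMap.id = _
    rw [← map_smul]
    rfl

theorem IsSemidualizing.gcClass_free [IsLocalRing R] (hC : IsSemidualizing R C) (n : ℕ) :
    GCClass R C (Fin n → R) := by
  induction n with
  | zero =>
    exact (gcClass_pow hC.perp 0).retract 0 0 (LinearMap.ext fun x => Subsingleton.elim _ _)
  | succ n ih => exact (hC.gcClass_ring.prod ih).equiv (Fin.consLinearEquiv R fun _ => R).symm

end FiniteResolution

/-! ### Complete resolutions by splicing, and the equivalence with `GCClass`. -/

section Glue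

variable {R : Type u} [CommRing R]

/-- The complex obtained by splicing short exact sequences `0 → Z (i + 1) → X i → Z i → 0`. -/
noncomputable abbrev splice {α : Type} [AddRightCancelSemigroup α] [One α] [DecidableEq α]
    (X Z : α → ModuleCat.{u} R) (ι : ∀ i, Z (i + 1) →ₗ[R] X i) (π : ∀ i, X i →ₗ[R] Z i)
    (h : ∀ i, ShortExactSeq (ι i) (π i)) : ChainComplex (ModuleCat.{u} R) α :=
  ChainComplex.of X (fun i => ModuleCat.ofHom (ι i ∘ₗ π (i + 1))) fun i => by
    ext x
    simp [(h (i + 1)).exact.apply_apply_eq_zero]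

theorem splice_d {α : Type} [AddRightCancelSemigroup α] [One α] [DecidableEq α]
    {X Z : α → ModuleCat.{u} R} {ι : ∀ i, Z (i + 1) →ₗ[R] X i} {π : ∀ i, X i →ₗ[R] Z i}
    (h : ∀ i, ShortExactSeq (ι i) (π i)) (i : α) :
    ((splice X Z ι π h).d (i + 1) i).hom = ι i ∘ₗ π (i + 1) :=
  congrArg ModuleCat.Hom.hom
    (ChainComplex.of_d X (fun i => ModuleCat.ofHom (ι i ∘ₗ π (i + 1))) i)

theorem splice_exact {α : Type} [AddRightCancelSemigroup α] [One α] [DecidableEq α]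
    {X Z : α → ModuleCat.{u} R} {ι : ∀ i, Z (i + 1) →ₗ[R] X i} {π : ∀ i, X i →ₗ[R] Z i}
    (h : ∀ i, ShortExactSeq (ι i) (π i)) (i : α) :
    Function.Exact ((splice X Z ι π h).d (i + 1 + 1) (i + 1)).hom
      ((splice X Z ι π h).d (i + 1) i).hom := by
  rw [splice_d, splice_d]
  intro x
  rw [LinearMap.comp_apply, map_eq_zero_iff _ (h i).inj, (h (i + 1)).exact x]
  constructor
  · rintro ⟨y, rfl⟩
    obtain ⟨z, rfl⟩ := (h (i + 1 + 1)).surj y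
    exact ⟨z, rfl⟩
  · rintro ⟨z, rfl⟩
    exact ⟨π _ z, rfl⟩

variable {C : Type u} [AddCommGroup C] [Module R C]

/-- `Hom(-, C ⊗ Q)` preserves exactness because `Ext¹(Z i, C ⊗ Q) = 0` lets maps extend along each
`ι i`. -/
theorem isCompletePCResolution_splice {X Z : ℤ → ModuleCat.{u} R} {ι : ∀ i, Z (i + 1) →ₗ[R] X i}
    {π : ∀ i, X i →ₗ[R] Z i} (h : ∀ i, ShortExactSeq (ι i) (π i))
    (hproj : ∀ i : ℤ, 0 ≤ i → Module.Projective R (X i))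
    (hC : ∀ i : ℤ, i < 0 → ∃ Q : ModuleCat.{u} R, Module.Projective R Q ∧
      Nonempty (X i ≃ₗ[R] C ⊗[R] Q))
    (hZ : ∀ i, Perp R C (Z i)) : IsCompletePCResolution R C (splice X Z ι π h) where
  projective := hproj
  cProjective := hC
  exact i := by
    obtain ⟨j, rfl⟩ : ∃ j, i = j + 1 := ⟨i - 1, by ring⟩
    generalize hk : j + 1 - 1 = k
    obtain rfl : j = k := by omega
    exact splice_exact h j
  hom_exact Q hQ i := by
    obtain ⟨j, rfl⟩ : ∃ j, i = j + 1 := ⟨i - 1, by ring⟩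
    generalize hk : j + 1 - 1 = k
    obtain rfl : j = k := by omega
    rw [splice_d, splice_d]
    intro φ
    constructor
    · intro hφ
      obtain ⟨ψ, hψ⟩ := (h (j + 1)).exists_factor φ (by
        refine LinearMap.ext fun y => ?_
        obtain ⟨z, rfl⟩ := (h (j + 1 + 1)).surj y
        exact LinearMap.congr_fun hφ z)
      obtain ⟨θ, hθ⟩ := (h j).exists_extension (hZ j Q hQ 0) ψ
      refine ⟨θ, ?_⟩
      change θ ∘ₗ ι j ∘ₗ π (j + 1) = φ
      rw [← LinearMap.comp_assoc, hθ, hψ]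
    · rintro ⟨θ, rfl⟩
      refine LinearMap.ext fun z => ?_
      change θ (ι j (π (j + 1) (ι (j + 1) _))) = 0
      rw [(h (j + 1)).exact.apply_apply_eq_zero, map_zero, map_zero]

/-- A projective resolution of `N`, whose syzygies stay in `Perp`, is spliced at `N` with the
iterated embeddings into modules `C ⊗ Q`. -/
theorem GCClass.isGCProjective {N : Type u} [AddCommGroup N] [Module R N]
    (hN : GCClass R C N) : IsGCProjective C (ModuleCat.of R N) := by
  choose P p hP hp using fun A : {A : ModuleCat.{u} R // Perp R C A} =>
    exists_projective_cover (R := R) A.1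
  choose Q D f g hQ hfg hD using fun A : {A : ModuleCat.{u} R // GCClass R C A} =>
    A.2.exists_coresolution
  let down : {A : ModuleCat.{u} R // Perp R C A} → {A : ModuleCat.{u} R // Perp R C A} :=
    fun A => ⟨ModuleCat.of R (LinearMap.ker (p A)),
      have := hP A
      (ShortExactSeq.ker (hp A)).perp_left perp_of_projective A.2⟩
  let up : {A : ModuleCat.{u} R // GCClass R C A} → {A : ModuleCat.{u} R // GCClass R C A} :=
    fun A => ⟨D A, hD A⟩
  let neg : ℕ → {A : ModuleCat.{u} R // GCClass R C A} := fun n =>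
    Nat.rec ⟨ModuleCat.of R N, hN⟩ (fun _ A => up A) n
  let pos : ℕ → {A : ModuleCat.{u} R // Perp R C A} :=
    fun n => Nat.rec ⟨ModuleCat.of R N, hN.perp⟩ (fun _ A => down A) n
  let Z : ℤ → ModuleCat.{u} R
    | Int.ofNat n => (pos n).1
    | Int.negSucc n => (neg (n + 1)).1
  have key : ∀ i : ℤ, ∃ (X : ModuleCat.{u} R) (ι : Z (i + 1) →ₗ[R] X) (π : X →ₗ[R] Z i),
      ShortExactSeq ι π ∧ (0 ≤ i → Module.Projective R X) ∧
      (i < 0 → ∃ Q : ModuleCat.{u} R, Module.Projective R Q ∧ Nonempty (X ≃ₗ[R] C ⊗[R] Q)) ∧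
      Perp R C (Z i) := by
    rintro (n | n)
    · exact ⟨P (pos n), (LinearMap.ker (p (pos n))).subtype, p (pos n),
        ShortExactSeq.ker (hp _), fun _ => hP _, fun h => absurd h (by simp), (pos n).2⟩
    -- `Z (Int.negSucc n + 1)` reduces to `neg n` only after a case split on `n`: for `n = 0` it is
    -- `pos 0`, the splice point `N`. Generalizing over `A` avoids a cast.
    · have key : ∀ A : ModuleCat.{u} R, A = (neg n).1 → ∃ (X : ModuleCat.{u} R)
          (ι : A →ₗ[R] X) (π : X →ₗ[R] D (neg n)),
          ShortExactSeq ι π ∧ (0 ≤ Int.negSucc n → Module.Projective R X) ∧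
          (Int.negSucc n < 0 → ∃ Q : ModuleCat.{u} R, Module.Projective R Q ∧
            Nonempty (X ≃ₗ[R] C ⊗[R] Q)) ∧ Perp R C (D (neg n)) := by
        rintro _ rfl
        exact ⟨ModuleCat.of R (C ⊗[R] Q (neg n)), f (neg n), g (neg n), hfg (neg n),
          fun h => absurd h (by simp),
          fun _ => ⟨Q (neg n), hQ _, ⟨LinearEquiv.refl R _⟩⟩, (hD _).perp⟩
      exact key (Z (Int.negSucc n + 1)) (by cases n <;> rfl)
  choose X ι π hs hpr hcp hperp using key
  refine ⟨splice X Z ι π hs, isCompletePCResolution_splice hs hpr hcp hperp, ?_⟩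
  have hr : LinearMap.range ((splice X Z ι π hs).d 1 0).hom = LinearMap.ker (π 0) := by
    change LinearMap.range ((splice X Z ι π hs).d (0 + 1) 0).hom = _
    rw [splice_d hs 0, LinearMap.range_comp, LinearMap.range_eq_top.2 (hs _).surj, Submodule.map_top]
    exact ((hs 0).exact.linearMap_ker_eq).symm
  exact ⟨((Submodule.quotEquivOfEq _ _ hr).trans
    ((π 0).quotKerEquivOfSurjective (hs 0).surj)).symm⟩

theorem IsCompletePCResolution.shortExactSeq {X : ChainComplex (ModuleCat.{u} R) ℤ}
    (hX : IsCompletePCResolution R C X) (i : ℤ) :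
    ∃ ι : (X.X (i + 1) ⧸ LinearMap.range (X.d (i + 1 + 1) (i + 1)).hom) →ₗ[R] X.X i,
      ι ∘ₗ (LinearMap.range (X.d (i + 1 + 1) (i + 1)).hom).mkQ = (X.d (i + 1) i).hom ∧
      ShortExactSeq ι (LinearMap.range (X.d (i + 1) i).hom).mkQ := by
  have hex : Function.Exact (X.d (i + 1 + 1) (i + 1)).hom (X.d (i + 1) i).hom := by
    have h := hX.exact (i + 1)
    rwa [add_sub_cancel_right] at h
  refine ⟨(LinearMap.range (X.d (i + 1 + 1) (i + 1)).hom).liftQ (X.d (i + 1) i).hom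
    hex.linearMap_ker_eq.ge, Submodule.liftQ_mkQ _ _ _, ?_, ?_, Submodule.mkQ_surjective _⟩
  · rw [← LinearMap.ker_eq_bot]
    exact Submodule.ker_liftQ_eq_bot _ _ _ hex.linearMap_ker_eq.le
  · rw [LinearMap.exact_iff, Submodule.ker_mkQ, Submodule.range_liftQ]

theorem IsCompletePCResolution.exists_extension {X : ChainComplex (ModuleCat.{u} R) ℤ}
    (hX : IsCompletePCResolution R C X) (i : ℤ)
    (ι : (X.X (i + 1) ⧸ LinearMap.range (X.d (i + 1 + 1) (i + 1)).hom) →ₗ[R] X.X i)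
    (hι : ι ∘ₗ (LinearMap.range (X.d (i + 1 + 1) (i + 1)).hom).mkQ = (X.d (i + 1) i).hom)
    (Q : ModuleCat.{u} R) (hQ : Module.Projective R Q)
    (φ : (X.X (i + 1) ⧸ LinearMap.range (X.d (i + 1 + 1) (i + 1)).hom) →ₗ[R] C ⊗[R] Q) :
    ∃ ψ : X.X i →ₗ[R] C ⊗[R] Q, ψ ∘ₗ ι = φ := by
  have hex := hX.hom_exact Q hQ (i + 1)
  rw [add_sub_cancel_right] at hex
  have h0 : (LinearMap.range (X.d (i + 1 + 1) (i + 1)).hom).mkQ ∘ₗ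
      (X.d (i + 1 + 1) (i + 1)).hom = 0 := LinearMap.range_mkQ_comp _
  obtain ⟨ψ, hψ⟩ := (hex (φ ∘ₗ (LinearMap.range (X.d (i + 1 + 1) (i + 1)).hom).mkQ)).1
    (by beta_reduce; rw [LinearMap.comp_assoc, h0, LinearMap.comp_zero])
  replace hψ : ψ ∘ₗ (X.d (i + 1) i).hom =
    φ ∘ₗ (LinearMap.range (X.d (i + 1 + 1) (i + 1)).hom).mkQ := hψ
  refine ⟨ψ, Submodule.linearMap_qext _ ?_⟩
  rw [LinearMap.comp_assoc, hι, hψ]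

/-- Exactness of `Hom(X, C ⊗ Q)` gives degree one at every index; higher degrees shift to the
cokernel at index `i + 1`. -/
theorem IsCompletePCResolution.perp (hC : Perp R C C) {X : ChainComplex (ModuleCat.{u} R) ℤ}
    (hX : IsCompletePCResolution R C X) (i : ℤ) :
    Perp R C (X.X i ⧸ LinearMap.range (X.d (i + 1) i).hom) := by
  have hXi : ∀ i, Perp R C (X.X i) := fun i => by
    rcases le_or_gt 0 i with hi | hi
    · have := hX.projective i hi
      exact perp_of_projective
    · obtain ⟨Q, hQ, ⟨e⟩⟩ := hX.cProjective i hi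
      exact (hC.tensor Q).equiv e
  intro Q _ _ hQ n
  induction n generalizing i with
  | zero =>
    obtain ⟨ι, hι, hs⟩ := hX.shortExactSeq i
    exact hs.extVanish_one (hXi i Q hQ 0) (hX.exists_extension i ι hι (ModuleCat.of R Q) hQ)
  | succ n ih =>
    obtain ⟨ι, hι, hs⟩ := hX.shortExactSeq i
    exact hs.extVanish_right (ih (i + 1)) (hXi i Q hQ (n + 1))

/-- The cokernels at indices `i ≤ 0` form a witness family. `k₀` is separate from `i₀ + 1` so that
the result applies directly to `X.d 1 0`. -/
theorem IsCompletePCResolution.gcClass (hC : Perp R C C) {X : ChainComplex (ModuleCat.{u} R) ℤ}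
    (hX : IsCompletePCResolution R C X) (k₀ i₀ : ℤ) (hi₀ : i₀ ≤ 0) (hk₀ : k₀ = i₀ + 1) :
    GCClass R C (X.X i₀ ⧸ LinearMap.range (X.d k₀ i₀).hom) := by
  subst hk₀
  refine ⟨fun Y => ∃ i : ℤ, i ≤ 0 ∧
    Nonempty (Y ≃ₗ[R] (X.X i ⧸ LinearMap.range (X.d (i + 1) i).hom)),
    ⟨i₀, hi₀, ⟨LinearEquiv.refl R _⟩⟩, ?_⟩
  rintro Y ⟨i, hi, ⟨e⟩⟩
  refine ⟨(hX.perp hC i).equiv e, ?_⟩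
  obtain ⟨j, rfl⟩ : ∃ j, i = j + 1 := ⟨i - 1, by ring⟩
  obtain ⟨ι, -, hs⟩ := hX.shortExactSeq j
  obtain ⟨Q, hQ, ⟨t⟩⟩ := hX.cProjective j (by omega)
  refine ⟨Q, ModuleCat.of R (X.X j ⧸ LinearMap.range (X.d (j + 1) j).hom),
    t.toLinearMap ∘ₗ ι ∘ₗ e.toLinearMap,
    (LinearMap.range (X.d (j + 1) j).hom).mkQ ∘ₗ t.symm.toLinearMap, hQ,
    ⟨t.injective.comp (hs.inj.comp e.injective), fun y => ?_, hs.surj.comp t.symm.surjective⟩,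
    j, by omega, ⟨LinearEquiv.refl R _⟩⟩
  obtain ⟨y, rfl⟩ := t.surjective y
  simp only [LinearMap.comp_apply, LinearEquiv.coe_coe, LinearEquiv.symm_apply_apply]
  refine (hs.exact y).trans ⟨?_, ?_⟩
  · rintro ⟨z, rfl⟩
    exact ⟨e.symm z, by simp⟩
  · rintro ⟨z, hz⟩
    exact ⟨e z, t.injective hz⟩

theorem isGCProjective_iff (hC : Perp R C C) (N : ModuleCat.{u} R) :
    IsGCProjective C N ↔ GCClass R C N := by
  constructor
  · rintro ⟨X, hX, ⟨e⟩⟩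
    exact (hX.gcClass hC 1 0 le_rfl (by norm_num)).equiv e
  · exact fun h => h.isGCProjective

end Glue

/-! ### Kernels of composites and restrictions to kernels. -/

section Kernels

variable {R : Type u} [CommRing R] {A B D T K X L G : Type u} [AddCommGroup A] [AddCommGroup B]
  [AddCommGroup D] [AddCommGroup T] [AddCommGroup K] [AddCommGroup X] [AddCommGroup L]
  [AddCommGroup G] [Module R A] [Module R B] [Module R D] [Module R T] [Module R K] [Module R X]
  [Module R L] [Module R G]

theorem ShortExactSeq.exists_lift_ker {f : A →ₗ[R] B} {g : B →ₗ[R] D} (h : ShortExactSeq f g)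
    (φ : T →ₗ[R] B) (hφ : g ∘ₗ φ = 0) : ∃ ψ : T →ₗ[R] A, f ∘ₗ ψ = φ := by
  have hr : ∀ x, φ x ∈ LinearMap.range f := fun x => (h.exact _).1 (LinearMap.congr_fun hφ x)
  refine ⟨(LinearEquiv.ofInjective f h.inj).symm.toLinearMap ∘ₗ φ.codRestrict _ hr,
    LinearMap.ext fun x => ?_⟩
  exact congrArg Subtype.val
    ((LinearEquiv.ofInjective f h.inj).apply_symm_apply (φ.codRestrict _ hr x))

theorem ShortExactSeq.congr_middle {f : A →ₗ[R] B} {g : B →ₗ[R] D} (h : ShortExactSeq f g)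
    (e : B ≃ₗ[R] X) : ShortExactSeq (e.toLinearMap ∘ₗ f) (g ∘ₗ e.symm.toLinearMap) :=
  ⟨e.injective.comp h.inj, fun y => by
    obtain ⟨y, rfl⟩ := e.surjective y
    simpa using h.exact y, h.surj.comp e.symm.surjective⟩

theorem ShortExactSeq.ker_comp_seq {a : K →ₗ[R] B} {b : B →ₗ[R] X} (h : ShortExactSeq a b)
    {l : L →ₗ[R] X} {t : X →ₗ[R] G} (h' : ShortExactSeq l t) :
    ∃ (v : K →ₗ[R] LinearMap.ker (t ∘ₗ b)) (w : LinearMap.ker (t ∘ₗ b) →ₗ[R] L),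
      ShortExactSeq v w := by
  obtain ⟨w, hw⟩ := h'.exists_lift_ker (b ∘ₗ (LinearMap.ker (t ∘ₗ b)).subtype)
    (LinearMap.ext fun x => x.2)
  replace hw : ∀ x, l (w x) = b x := LinearMap.congr_fun hw
  refine ⟨a.codRestrict _ fun x => ?_, w, fun x y hxy => h.inj (congrArg Subtype.val hxy),
    fun x => ⟨fun hx => ?_, ?_⟩, fun y => ?_⟩
  · rw [LinearMap.mem_ker, LinearMap.comp_apply, h.exact.apply_apply_eq_zero, map_zero]
  · have := hw x
    rw [hx, map_zero] at this
    obtain ⟨z, hz⟩ := (h.exact _).1 this.symm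
    exact ⟨z, Subtype.ext hz⟩
  · rintro ⟨z, rfl⟩
    exact h'.inj ((hw _).trans ((h.exact.apply_apply_eq_zero z).trans (map_zero l).symm))
  · obtain ⟨z, hz⟩ := h.surj (l y)
    refine ⟨⟨z, ?_⟩, h'.inj ?_⟩
    · rw [LinearMap.mem_ker, LinearMap.comp_apply, hz, h'.exact.apply_apply_eq_zero]
    · rw [hw, hz]

/-- Since `s` is already surjective on `A`, preimages of elements of `D` can be corrected to lie in
`ker s`. This cuts down `A` and `B` without changing `D`. -/
theorem ShortExactSeq.restrict_ker {f : A →ₗ[R] B} {g : B →ₗ[R] D} (h : ShortExactSeq f g)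
    (s : B →ₗ[R] T) (hs : Function.Surjective (s ∘ₗ f)) :
    ShortExactSeq ((f ∘ₗ (LinearMap.ker (s ∘ₗ f)).subtype).codRestrict (LinearMap.ker s)
      fun x => x.2) (g ∘ₗ (LinearMap.ker s).subtype) := by
  refine ⟨fun x y hxy => Subtype.ext (h.inj (congrArg Subtype.val hxy)),
    fun x => ⟨fun hx => ?_, ?_⟩, fun y => ?_⟩
  · obtain ⟨z, hz⟩ := (h.exact _).1 hx
    exact ⟨⟨z, (congrArg s hz).trans x.2⟩, Subtype.ext hz⟩
  · rintro ⟨z, rfl⟩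
    exact h.exact.apply_apply_eq_zero _
  · obtain ⟨z, rfl⟩ := h.surj y
    obtain ⟨x, hx⟩ := hs (s z)
    refine ⟨⟨z - f x, ?_⟩, ?_⟩
    · rw [LinearMap.mem_ker, map_sub, sub_eq_zero]
      exact hx.symm
    · change g (z - f x) = g z
      rw [map_sub, h.exact.apply_apply_eq_zero, sub_zero]

end Kernels

/-! ### Approximations of modules of finite G_C-projective dimension. -/

section Approximation

variable (R : Type u) [CommRing R] (C : Type u) [AddCommGroup C] [Module R C]

/-- `M` has a resolution of length at most `n` by modules in `GCClass`. -/
def GCDimLE : ℕ → ModuleCat.{u} R → Prop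
  | 0, M => GCClass R C M
  | n + 1, M => ∃ (K G : ModuleCat.{u} R) (i : K →ₗ[R] G) (p : G →ₗ[R] M),
      ShortExactSeq i p ∧ GCClass R C G ∧ GCDimLE n K

/-- `K` has a resolution of length less than `n` by finite powers of `C`. -/
def CResolvable : ℕ → ModuleCat.{u} R → Prop
  | 0, K => Subsingleton K
  | n + 1, K => ∃ (a : ℕ) (L : ModuleCat.{u} R) (f : L →ₗ[R] (Fin a → C))
      (p : (Fin a → C) →ₗ[R] K), ShortExactSeq f p ∧ CResolvable n L

variable {R C}

theorem GCDimLE.prod {n : ℕ} {M P : ModuleCat.{u} R} (h : GCDimLE R C n M)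
    (hP : GCClass R C P) : GCDimLE R C n (ModuleCat.of R (M × P)) := by
  cases n with
  | zero => exact GCClass.prod h hP
  | succ n =>
    obtain ⟨K, G, i, p, hs, hG, hK⟩ := h
    refine ⟨K, ModuleCat.of R (G × P), LinearMap.inl R G P ∘ₗ i, p.prodMap LinearMap.id,
      ⟨LinearMap.inl_injective.comp hs.inj, fun x => ⟨fun hx => ?_, ?_⟩, fun y => ?_⟩,
      hG.prod hP, hK⟩
    · have h1 : p x.1 = 0 := congrArg Prod.fst hx
      have h2 : x.2 = 0 := congrArg Prod.snd hx
      obtain ⟨z, hz⟩ := (hs.exact _).1 h1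
      exact ⟨z, Prod.ext hz h2.symm⟩
    · rintro ⟨z, rfl⟩
      exact Prod.ext (hs.exact.apply_apply_eq_zero z) rfl
    · obtain ⟨z, hz⟩ := hs.surj y.1
      exact ⟨(z, y.2), Prod.ext hz rfl⟩

/-- As in Schanuel's lemma, lifting `P → M` to `G` gives `0 → L → K × P → G → 0`. A G_C-projective
cover `G₁` of `K × P` then restricts to the kernel of `G₁ → G`, which is again G_C-projective and
covers `L`. -/
theorem GCDimLE.syzygy {n : ℕ} {M L P : ModuleCat.{u} R} (h : GCDimLE R C (n + 1) M)
    [Module.Projective R P] (hP : GCClass R C P) {f : L →ₗ[R] P} {p : P →ₗ[R] M}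
    (hs : ShortExactSeq f p) : GCDimLE R C n L := by
  obtain ⟨K, G, ι, π, hιπ, hG, hK⟩ := h
  obtain ⟨s, hsp⟩ := Module.projective_lifting_property π p hιπ.surj
  obtain ⟨c, hc⟩ := hιπ.exists_lift_ker (-(s ∘ₗ f)) (by
    rw [LinearMap.comp_neg, ← LinearMap.comp_assoc, hsp, hs.comp_eq_zero, neg_zero])
  replace hsp : ∀ x, π (s x) = p x := LinearMap.congr_fun hsp
  replace hc : ∀ x, ι (c x) = -s (f x) := LinearMap.congr_fun hc
  have hX : ShortExactSeq (c.prod f) (ι.coprod s) := by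
    refine ⟨fun x y hxy => hs.inj (congrArg Prod.snd hxy), fun x => ⟨fun hx => ?_, ?_⟩,
      fun g => ?_⟩
    · obtain ⟨k, x⟩ := x
      replace hx : ι k + s x = 0 := hx
      have h1 : p x = 0 := by
        have := congrArg π hx
        rwa [map_add, hιπ.exact.apply_apply_eq_zero, zero_add, hsp, map_zero] at this
      obtain ⟨l, rfl⟩ := (hs.exact _).1 h1
      refine ⟨l, Prod.ext (hιπ.inj ?_) rfl⟩
      change ι (c l) = ι k
      rw [hc, eq_comm, eq_neg_iff_add_eq_zero, hx]
    · rintro ⟨l, rfl⟩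
      simp [hc]
    · obtain ⟨x, hx⟩ := hs.surj (π g)
      obtain ⟨k, hk⟩ := (hιπ.exact (g - s x)).1 (by rw [map_sub, hsp, hx, sub_self])
      exact ⟨(k, x), by simp [hk]⟩
  cases n with
  | zero => exact hX.gcClass_left (GCClass.prod hK hP) hG
  | succ n =>
    obtain ⟨K₁, G₁, i, q, hq, hG₁, hK₁⟩ := hK.prod hP
    obtain ⟨v, w, hvw⟩ := hq.ker_comp_seq hX
    exact ⟨K₁, ModuleCat.of R (LinearMap.ker (ι.coprod s ∘ₗ q)), v, w, hvw,
      (ShortExactSeq.ker (show Function.Surjective (ι.coprod s ∘ₗ q) from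
        hX.surj.comp hq.surj)).gcClass_left hG₁ hG, hK₁⟩

theorem CResolvable.succ {n : ℕ} {K : ModuleCat.{u} R} (h : CResolvable R C n K) :
    CResolvable R C (n + 1) K := by
  induction n generalizing K with
  | zero =>
    have : Subsingleton K := h
    exact ⟨0, K, 0, 0, ⟨fun _ _ _ => Subsingleton.elim _ _,
      fun x => ⟨fun _ => ⟨0, Subsingleton.elim _ _⟩, fun _ => rfl⟩,
      fun y => ⟨0, Subsingleton.elim _ _⟩⟩, h⟩
  | succ n ih =>
    obtain ⟨a, L, f, p, hs, hL⟩ := h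
    exact ⟨a, L, f, p, hs, ih hL⟩

/-- Shifting degree up lowers the length of the `C`-resolution until the zero module is reached.
This vanishing yields properness. -/
theorem CResolvable.extVanish {Y : Type u} [AddCommGroup Y] [Module R Y] (hY : Perp R C Y)
    {m : ℕ} {K : ModuleCat.{u} R} (h : CResolvable R C m K) (n : ℕ) :
    ExtVanish R (n + 1) Y K := by
  induction m generalizing K n with
  | zero =>
    have : Subsingleton K := h
    exact extVanish_of_subsingleton (n + 1)
  | succ m ih =>
    obtain ⟨a, L, f, p, hs, hL⟩ := h
    exact hs.extVanish_cov_right (hY.extVanish_pow a n) (ih hL (n + 1))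

/-- Induction on `d`: approximate the first syzygy of `M` by `0 → K → G → ker q → 0`, embed `G` in
`Cᵃ` with cokernel `N` in the class, and take the cokernel of `G → Cᵃ × Rⁿ` as the new
approximation. -/
theorem exists_approximation [IsLocalRing R] (hC : IsSemidualizing R C) (d : ℕ)
    {M : ModuleCat.{u} R} (hM : HasFiniteProjectiveResolution R M) (hd : GCDimLE R C d M) :
    ∃ (K G : ModuleCat.{u} R) (i : K →ₗ[R] G) (p : G →ₗ[R] M), ShortExactSeq i p ∧
      GCClass R C G ∧ Module.Finite R G ∧ CResolvable R C d K := by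
  induction d generalizing M with
  | zero =>
    refine ⟨ModuleCat.of R PUnit.{u + 1}, M, 0, LinearMap.id,
      ⟨fun _ _ _ => rfl, fun x => ?_, Function.surjective_id⟩, hd, hM.finite,
      inferInstanceAs (Subsingleton PUnit.{u + 1})⟩
    exact ⟨fun hx => ⟨0, hx.symm⟩, by rintro ⟨_, rfl⟩; rfl⟩
  | succ d ih =>
    obtain ⟨n, q, hq, hL⟩ := hM.exists_free_cover
    have hsq := ShortExactSeq.ker hq
    have hdL : GCDimLE R C d (ModuleCat.of R (LinearMap.ker q)) :=
      GCDimLE.syzygy (P := ModuleCat.of R (Fin n → R)) (L := ModuleCat.of R (LinearMap.ker q))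
        hd (hC.gcClass_free n) hsq
    obtain ⟨K, G, i, p, hs, hG, hfin, hK⟩ := ih hL hdL
    obtain ⟨a, N, j, c, hj, hN⟩ := hG.exists_finite_coresolution hC.perp
    let F : G →ₗ[R] (Fin a → C) × (Fin n → R) := j.prod ((LinearMap.ker q).subtype ∘ₗ p)
    have hF : Function.Injective F := fun x y hxy => hj.inj (congrArg Prod.fst hxy)
    have hcol := ShortExactSeq.range hF
    have hji := ShortExactSeq.range (show Function.Injective (j ∘ₗ i) from hj.inj.comp hs.inj)
    -- `0 → Rⁿ → coker F → N → 0` shows that `coker F` is in the class.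
    obtain ⟨v, w, hvw⟩ := ShortExactSeq.coker_seq
      (f := (0 : PUnit.{u + 1} →ₗ[R] G)) (g := LinearMap.id)
      (f₁ := LinearMap.inr R (Fin a → C) (Fin n → R)) (g₁ := LinearMap.fst R _ _)
      (a := (0 : PUnit.{u + 1} →ₗ[R] (Fin n → R))) (a' := LinearMap.id)
      ⟨fun _ _ _ => rfl, fun x => ⟨fun hx => ⟨0, hx.symm⟩, by rintro ⟨_, rfl⟩; rfl⟩,
        Function.surjective_id⟩
      ⟨LinearMap.inr_injective, Function.Exact.inr_fst, LinearMap.fst_surjective⟩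
      ⟨fun _ _ _ => rfl, fun x => ⟨fun hx => ⟨0, hx.symm⟩, by rintro ⟨_, rfl⟩; rfl⟩,
        Function.surjective_id⟩
      hcol hj (fun x => by simp only [LinearMap.zero_apply, map_zero]) (fun x => rfl)
    -- `0 → Cᵃ/K → coker F → M → 0` is the approximation; its kernel is resolved one step further
    -- than `K`.
    obtain ⟨v', w', hvw'⟩ := hs.coker_seq
      (f₁ := LinearMap.inl R (Fin a → C) (Fin n → R)) (g₁ := LinearMap.snd R _ _)
      ⟨LinearMap.inl_injective, Function.Exact.inl_snd, LinearMap.snd_surjective⟩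
      hji hcol hsq (fun x => by simp [F, hs.exact.apply_apply_eq_zero]) (fun x => rfl)
    have := hC.resolution.finite
    exact ⟨ModuleCat.of R _, ModuleCat.of R _, v', w', hvw',
      hvw.gcClass_middle (hC.gcClass_free n) hN, Module.Finite.of_surjective _ hcol.surj,
      a, K, j ∘ₗ i, _, hji, hK⟩

theorem gcDimLE_of_resolution (hC : Perp R C C) (N : ℕ) {M : ModuleCat.{u} R}
    (X : GCResolution R C M) (hX : ∀ n, N < n → Subsingleton (X.complex.X n)) :
    GCDimLE R C N M := by
  induction N generalizing M with
  | zero =>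
    have h0 := (isGCProjective_iff hC _).1 (X.mem 0)
    have := hX 1 one_pos
    have hinj : Function.Injective X.aug := by
      refine (injective_iff_map_eq_zero _).2 fun x hx => ?_
      obtain ⟨y, rfl⟩ := (X.exact_zero x).1 hx
      rw [Subsingleton.elim y 0, map_zero]
    exact h0.equiv (LinearEquiv.ofBijective X.aug ⟨hinj, X.aug_surjective⟩).symm
  | succ N ih =>
    exact ⟨ModuleCat.of R (LinearMap.ker X.aug), X.complex.X 0, _, _,
      ShortExactSeq.ker X.aug_surjective, (isGCProjective_iff hC _).1 (X.mem 0),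
      ih X.syzygy fun n hn => hX (n + 1) (by omega)⟩

theorem exists_gcDimLE (hC : Perp R C C) {M : Type u} [AddCommGroup M] [Module R M]
    (h : gcProjDim R C M < ⊤) : ∃ N, GCDimLE R C N (ModuleCat.of R M) := by
  obtain ⟨X, hX⟩ := iInf_lt_iff.1 h
  obtain ⟨N, hN⟩ : ∃ N : ℕ, (⨆ n : {n : ℕ // Nontrivial (X.complex.X n)},
      (((n : ℕ) : ℕ∞) : WithBot ℕ∞)) ≤ ((N : ℕ∞) : WithBot ℕ∞) := by
    generalize (⨆ n : {n : ℕ // Nontrivial (X.complex.X n)},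
      (((n : ℕ) : ℕ∞) : WithBot ℕ∞)) = s at hX
    induction s using WithBot.recBotCoe with
    | bot => exact ⟨0, bot_le⟩
    | coe s =>
      have hs : s ≠ ⊤ := by
        rintro rfl
        exact absurd hX (lt_irrefl _)
      exact ⟨s.toNat, by rw [ENat.natCast_toNat hs]⟩
  refine ⟨N, gcDimLE_of_resolution hC N (M := ModuleCat.of R M) X fun n hn => ?_⟩
  by_contra hnt
  have hnt' := not_subsingleton_iff_nontrivial.1 hnt
  have h1 := (le_iSup (fun n : {n : ℕ // Nontrivial (X.complex.X n)} =>
    (((n : ℕ) : ℕ∞) : WithBot ℕ∞)) ⟨n, hnt'⟩).trans hN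
  exact absurd (Nat.cast_le.1 (WithBot.coe_le_coe.1 h1)) (not_le.2 hn)

end Approximation

open IsLocalRing

/-! ### Splitting off copies of `C` and minimal choices. -/

section MinimalPresentation

variable {R : Type u} [CommRing R] [IsLocalRing R] {C : Type u} [AddCommGroup C] [Module R C]

theorem IsSemidualizing.nontrivial (hC : IsSemidualizing R C) : Nontrivial C := by
  by_contra h
  have := not_nontrivial_iff_subsingleton.1 h
  exact one_ne_zero (hC.eq_of_smul_eq fun c => Subsingleton.elim ((1 : R) • c) ((0 : R) • c))

/-- Nakayama: multiplication by elements of the maximal ideal does not fill `C`. -/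
theorem IsSemidualizing.maximalIdeal_smul_ne_top (hC : IsSemidualizing R C) :
    maximalIdeal R • (⊤ : Submodule R C) ≠ ⊤ := by
  have := hC.resolution.finite
  have := hC.nontrivial
  intro h
  refine (bot_ne_top (α := Submodule R C)) (Eq.symm ?_)
  exact Submodule.eq_bot_of_le_smul_of_le_jacobson_bot (maximalIdeal R) ⊤
    Module.Finite.fg_top h.ge (maximalIdeal_le_jacobson ⊥)

/-- The components of `s` are multiplications by ring elements. If all of these were in `𝔪`, the
image would lie in `𝔪C ≠ C`. -/
theorem IsSemidualizing.exists_isUnit_of_surjective (hC : IsSemidualizing R C) {a : ℕ}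
    {s : (Fin a → C) →ₗ[R] C} (hs : Function.Surjective s) :
    ∃ (i : Fin a) (r : R), IsUnit r ∧ ∀ c, s (Pi.single i c) = r • c := by
  choose r hr using fun i => hC.exists_smul (s ∘ₗ LinearMap.single R (fun _ => C) i)
  by_contra! h
  refine hC.maximalIdeal_smul_ne_top (top_le_iff.1 fun c _ => ?_)
  obtain ⟨x, rfl⟩ := hs c
  rw [← Finset.univ_sum_single x, map_sum]
  refine Submodule.sum_mem _ fun i _ => ?_
  have hi : r i ∈ maximalIdeal R := by
    rw [mem_maximalIdeal, mem_nonunits_iff]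
    intro hu
    obtain ⟨c, hc⟩ := h i (r i) hu
    exact hc (hr i c)
  rw [show s (Pi.single i (x i)) = r i • x i from hr i (x i)]
  exact Submodule.smul_mem_smul hi trivial

/-- The kernel of a surjection `Cᵃ → C` is isomorphic to `Cᵃ⁻¹`. -/
theorem IsSemidualizing.exists_ker_equiv (hC : IsSemidualizing R C) {a : ℕ}
    {s : (Fin a → C) →ₗ[R] C} (hs : Function.Surjective s) :
    ∃ b, a = b + 1 ∧ Nonempty (LinearMap.ker s ≃ₗ[R] (Fin b → C)) := by
  obtain ⟨i, r, hr, hsr⟩ := hC.exists_isUnit_of_surjective hs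
  obtain ⟨b, rfl⟩ : ∃ b, a = b + 1 := ⟨a - 1, by have := i.pos; omega⟩
  -- Dropping coordinate `i` is bijective on the kernel: `s` acts on it by a unit, so the other
  -- coordinates determine it.
  refine ⟨b, rfl, ⟨LinearEquiv.ofBijective
    (LinearMap.funLeft R C i.succAbove ∘ₗ (LinearMap.ker s).subtype) ⟨?_, fun y => ?_⟩⟩⟩
  · refine (injective_iff_map_eq_zero _).2 fun x hx => Subtype.ext ?_
    have h1 : (x : Fin (b + 1) → C) = Pi.single i ((x : Fin (b + 1) → C) i) := by
      refine funext fun j => ?_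
      rcases Fin.eq_self_or_eq_succAbove i j with rfl | ⟨k, rfl⟩
      · simp
      · rw [Pi.single_eq_of_ne (Fin.succAbove_ne i k)]
        exact congrFun hx k
    have h2 : s x = 0 := x.2
    rw [h1, hsr, hr.smul_eq_zero] at h2
    rw [h1, h2, Pi.single_zero]
    rfl
  · obtain ⟨u, rfl⟩ := hr
    let z : Fin (b + 1) → C := i.insertNth 0 y
    refine ⟨⟨z - Pi.single i ((↑u⁻¹ : R) • s z), ?_⟩, funext fun k => ?_⟩
    · rw [LinearMap.mem_ker, map_sub, hsr, smul_smul, Units.mul_inv, one_smul, sub_self]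
    · simp [z, LinearMap.funLeft_apply]

theorem mem_maximalIdeal_smul_pow {a : ℕ} {x : Fin a → C}
    (hx : ∀ i, x i ∈ maximalIdeal R • (⊤ : Submodule R C)) :
    x ∈ maximalIdeal R • (⊤ : Submodule R (Fin a → C)) := by
  rw [← Finset.univ_sum_single x]
  refine Submodule.sum_mem _ fun i _ => ?_
  have h1 := Submodule.mem_map_of_mem (f := LinearMap.single R (fun _ : Fin a => C) i) (hx i)
  rw [Submodule.map_smul''] at h1
  exact Submodule.smul_mono le_rfl le_top h1

/-- The length does not grow: `Cᵃ` is replaced by the kernel of `Cᵃ → K → C`, again a power of `C`,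
and `L` is kept. -/
theorem CResolvable.ker (hC : IsSemidualizing R C) {n : ℕ} {K : ModuleCat.{u} R}
    (h : CResolvable R C n K) {r : K →ₗ[R] C} (hr : Function.Surjective r) :
    CResolvable R C n (ModuleCat.of R (LinearMap.ker r)) := by
  cases n with
  | zero =>
    have : Subsingleton K := h
    exact inferInstanceAs (Subsingleton (LinearMap.ker r))
  | succ n =>
    obtain ⟨a, L, f, p, hs, hL⟩ := h
    obtain ⟨b, -, ⟨e⟩⟩ := hC.exists_ker_equiv
      (show Function.Surjective (r ∘ₗ p) from hr.comp hs.surj)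
    obtain ⟨v, w, hvw⟩ := hs.ker_comp_seq (ShortExactSeq.ker hr)
    exact ⟨b, L, _, _, hvw.congr_middle e, hL⟩

/-- A map `L → C` from a module with a finite `C`-resolution is surjective or has image in
`𝔪C`. -/
theorem CResolvable.surjective_or (hC : IsSemidualizing R C) {n : ℕ} {L : ModuleCat.{u} R}
    (h : CResolvable R C n L) (r : L →ₗ[R] C) :
    Function.Surjective r ∨ ∀ x, r x ∈ maximalIdeal R • (⊤ : Submodule R C) := by
  obtain ⟨a, L', f, p, hs, -⟩ := h.succ
  choose t ht using fun i => hC.exists_smul (r ∘ₗ p ∘ₗ LinearMap.single R (fun _ => C) i)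
  by_cases hu : ∃ i, IsUnit (t i)
  · obtain ⟨i, u, hu⟩ := hu
    refine Or.inl fun c => ⟨p (Pi.single i ((↑u⁻¹ : R) • c)), ?_⟩
    refine (ht i _).trans ?_
    rw [← hu, smul_smul, Units.mul_inv, one_smul]
  · refine Or.inr fun x => ?_
    obtain ⟨y, rfl⟩ := hs.surj x
    rw [← Finset.univ_sum_single y, map_sum, map_sum]
    refine Submodule.sum_mem _ fun i _ => ?_
    rw [show r (p (Pi.single i (y i))) = t i • y i from ht i (y i)]
    exact Submodule.smul_mem_smul
      ((mem_maximalIdeal _).2 (mem_nonunits_iff.2 fun h => hu ⟨i, h⟩)) trivial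

/-- Take the least possible `a`. A coordinate of `f` not landing in `𝔪C` would be surjective, and
passing to kernels would give a presentation with fewer copies of `C`. -/
theorem CResolvable.exists_minimal_presentation (hC : IsSemidualizing R C) {n : ℕ}
    {K : ModuleCat.{u} R} (h : CResolvable R C (n + 1) K) :
    ∃ (a : ℕ) (L : ModuleCat.{u} R) (f : L →ₗ[R] (Fin a → C)) (p : (Fin a → C) →ₗ[R] K),
      ShortExactSeq f p ∧ CResolvable R C n L ∧
      ∀ x, f x ∈ maximalIdeal R • (⊤ : Submodule R (Fin a → C)) := by
  classical
  have h' : ∃ a : ℕ, ∃ (L : ModuleCat.{u} R) (f : L →ₗ[R] (Fin a → C))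
    (p : (Fin a → C) →ₗ[R] K), ShortExactSeq f p ∧ CResolvable R C n L := h
  obtain ⟨L, f, p, hs, hL⟩ := Nat.find_spec h'
  refine ⟨_, L, f, p, hs, hL, fun x => mem_maximalIdeal_smul_pow fun i => ?_⟩
  refine (hL.surjective_or hC (LinearMap.proj i ∘ₗ f)).elim (fun hsurj => ?_) fun hx => hx x
  obtain ⟨b, hb, ⟨e⟩⟩ := hC.exists_ker_equiv (s := LinearMap.proj i) (fun c => ⟨fun _ => c, rfl⟩)
  exact absurd ⟨_, _, _, (hs.restrict_ker (LinearMap.proj i) hsurj).congr_middle e,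
    hL.ker hC hsurj⟩ (Nat.find_min h' (m := b) (by omega))

/-- Minimize the number of copies of `C` covering `K`. A `C`-summand of `G` inside the image of `K`
gives `r : G → C` with `r ∘ i` surjective; restricting to kernels keeps `M` and lowers that number.
-/
theorem exists_minimal_approximation (hC : IsSemidualizing R C) {n : ℕ} {M : ModuleCat.{u} R}
    (h : ∃ (K G : ModuleCat.{u} R) (i : K →ₗ[R] G) (p : G →ₗ[R] M), ShortExactSeq i p ∧
      GCClass R C G ∧ CResolvable R C n K) :
    ∃ (K G : ModuleCat.{u} R) (i : K →ₗ[R] G) (p : G →ₗ[R] M), ShortExactSeq i p ∧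
      GCClass R C G ∧ CResolvable R C (n + 1) K ∧ ¬ ContainsCSummand C (LinearMap.range i) := by
  classical
  have h' : ∃ a : ℕ, ∃ (K G L : ModuleCat.{u} R) (i : K →ₗ[R] G) (p : G →ₗ[R] M)
      (f : L →ₗ[R] (Fin a → C)) (q : (Fin a → C) →ₗ[R] K), ShortExactSeq i p ∧
      GCClass R C G ∧ ShortExactSeq f q ∧ CResolvable R C n L := by
    obtain ⟨K, G, i, p, hs, hG, hK⟩ := h
    obtain ⟨a, L, f, q, hf, hL⟩ := hK.succ
    exact ⟨a, K, G, L, i, p, f, q, hs, hG, hf, hL⟩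
  obtain ⟨K, G, L, i, p, f, q, hs, hG, hf, hL⟩ := Nat.find_spec h'
  refine ⟨K, G, i, p, hs, hG, ⟨_, L, f, q, hf, hL⟩, ?_⟩
  rintro ⟨N, hN, ⟨e⟩, N', hc⟩
  let r : G →ₗ[R] C := e.toLinearMap ∘ₗ N.projectionOnto N' hc
  have hri : Function.Surjective (r ∘ₗ i) := fun c => by
    obtain ⟨x, hx⟩ := hN (e.symm c).2
    refine ⟨x, ?_⟩
    simp only [r, LinearMap.comp_apply, hx]
    simp
  obtain ⟨b, hb, ⟨e'⟩⟩ := hC.exists_ker_equiv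
    (show Function.Surjective ((r ∘ₗ i) ∘ₗ q) from hri.comp hf.surj)
  obtain ⟨v, w, hvw⟩ := hf.ker_comp_seq (ShortExactSeq.ker hri)
  have hr : Function.Surjective r := Function.Surjective.of_comp hri
  exact absurd ⟨ModuleCat.of R _, ModuleCat.of R (LinearMap.ker r), L, _, _, _, _,
    hs.restrict_ker r hri, (ShortExactSeq.ker hr).gcClass_left hG (gcClass_self hC.perp),
    hvw.congr_middle e', hL⟩ (Nat.find_min h' (m := b) (by omega))

end MinimalPresentation

/-! ### Construction of a proper resolution satisfying the minimality conditions. -/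

section SpliceResolution

variable {R : Type u} [CommRing R]

/-- The resolution obtained by splicing short exact sequences `0 → Z (n + 1) → X n → Z n → 0`. -/
noncomputable def spliceResolution {𝒳 : ModuleCat.{u} R → Prop} {X Z : ℕ → ModuleCat.{u} R}
    {ι : ∀ i, Z (i + 1) →ₗ[R] X i} {π : ∀ i, X i →ₗ[R] Z i}
    (h : ∀ i, ShortExactSeq (ι i) (π i)) (hX : ∀ n, 𝒳 (X n)) : LeftResolution 𝒳 (Z 0) where
  complex := splice X Z ι π h
  mem := hX
  aug := π 0
  aug_surjective := (h 0).surj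
  exact_zero := by
    change Function.Exact ((splice X Z ι π h).d (0 + 1) 0).hom (π 0)
    rw [splice_d]
    intro x
    refine ((h 0).exact x).trans ⟨?_, ?_⟩
    · rintro ⟨y, rfl⟩
      obtain ⟨z, rfl⟩ := (h 1).surj y
      exact ⟨z, rfl⟩
    · rintro ⟨z, rfl⟩
      exact ⟨π _ z, rfl⟩
  exact_succ n := splice_exact h n

theorem spliceResolution_isProper {𝒳 : ModuleCat.{u} R → Prop} {X Z : ℕ → ModuleCat.{u} R}
    {ι : ∀ i, Z (i + 1) →ₗ[R] X i} {π : ∀ i, X i →ₗ[R] Z i}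
    (h : ∀ i, ShortExactSeq (ι i) (π i)) (hX : ∀ n, 𝒳 (X n))
    (hZ : ∀ (Y : ModuleCat.{u} R), 𝒳 Y → ∀ n, ExtVanish R 1 Y (Z (n + 1))) :
    (spliceResolution h hX).IsProper := by
  intro Y hY
  have hlift : ∀ n (φ : Y →ₗ[R] Z n), ∃ ψ : Y →ₗ[R] X n, π n ∘ₗ ψ = φ :=
    fun n φ => (h n).exists_lift (hZ Y hY n) φ
  have hker : ∀ n (φ : Y →ₗ[R] X n), π n ∘ₗ φ = 0 ↔
      ∃ ψ : Y →ₗ[R] X (n + 1), (ι n ∘ₗ π (n + 1)) ∘ₗ ψ = φ := fun n φ => by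
    constructor
    · intro hφ
      obtain ⟨ψ, hψ⟩ := (h n).exists_lift_ker φ hφ
      obtain ⟨θ, hθ⟩ := hlift (n + 1) ψ
      exact ⟨θ, by rw [LinearMap.comp_assoc, hθ, hψ]⟩
    · rintro ⟨ψ, rfl⟩
      rw [← LinearMap.comp_assoc, ← LinearMap.comp_assoc, (h n).comp_eq_zero,
        LinearMap.zero_comp, LinearMap.zero_comp]
  refine ⟨hlift 0, fun φ => ?_, fun n φ => ?_⟩
  · change π 0 ∘ₗ φ = 0 ↔ ∃ ψ : Y →ₗ[R] X 1, ((splice X Z ι π h).d (0 + 1) 0).hom ∘ₗ ψ = φ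
    rw [splice_d]
    exact hker 0 φ
  · change ((splice X Z ι π h).d (n + 1) n).hom ∘ₗ φ = 0 ↔
      ∃ ψ : Y →ₗ[R] X (n + 2), ((splice X Z ι π h).d (n + 1 + 1) (n + 1)).hom ∘ₗ ψ = φ
    rw [splice_d, splice_d, ← hker (n + 1) φ]
    refine ⟨fun hφ => LinearMap.ext fun y => (h n).inj ?_, fun hφ => ?_⟩
    · rw [LinearMap.zero_apply, map_zero]
      exact LinearMap.congr_fun hφ y
    · exact LinearMap.ext fun y =>
        (congrArg (ι n) (LinearMap.congr_fun hφ y)).trans (map_zero (ι n))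

theorem exists_proper_minimalityConditions_of_splice [IsLocalRing R] {C : Type u}
    [AddCommGroup C] [Module R C] (hC : Perp R C C) (Z : ℕ → ModuleCat.{u} R)
    (key : ∀ n : ℕ, ∃ (X : ModuleCat.{u} R) (ι : Z (n + 1) →ₗ[R] X) (π : X →ₗ[R] Z n),
      ShortExactSeq ι π ∧ IsGCProjective C X ∧ (∃ m, CResolvable R C m (Z (n + 1))) ∧
      (n = 0 → ¬ ContainsCSummand C (LinearMap.range ι)) ∧
      (1 ≤ n → (∃ α : ℕ, Nonempty (X ≃ₗ[R] (Fin α → C))) ∧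
        ∀ x, ι x ∈ maximalIdeal R • (⊤ : Submodule R X))) :
    ∃ H : GCResolution R C (Z 0), H.IsProper ∧ MinimalityConditions C H.complex := by
  choose X ι π hι hX hZ h0 h1 using key
  refine ⟨spliceResolution hι hX, spliceResolution_isProper hι hX fun Y hY n => ?_,
    fun n hn => (h1 n hn).1, fun n hn => ?_, ?_⟩
  · obtain ⟨m, hm⟩ := hZ n
    exact hm.extVanish ((isGCProjective_iff hC Y).1 hY).perp 0
  · obtain ⟨k, rfl⟩ : ∃ k, n = k + 1 + 1 := ⟨n - 2, by omega⟩
    change LinearMap.range ((splice X Z ι π hι).d (k + 1 + 1) (k + 1)).hom ≤ _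
    rw [splice_d]
    rintro _ ⟨x, rfl⟩
    exact (h1 (k + 1) (Nat.le_add_left 1 k)).2 _
  · change ¬ ContainsCSummand C (LinearMap.range ((splice X Z ι π hι).d (0 + 1) 0).hom)
    rw [splice_d, LinearMap.range_comp, LinearMap.range_eq_top.2 (hι _).surj, Submodule.map_top]
    exact h0 0 rfl

theorem exists_proper_minimalityConditions [IsLocalRing R] {C : Type u} [AddCommGroup C]
    [Module R C] (hC : IsSemidualizing R C) {M : Type u} [AddCommGroup M] [Module R M]
    (hdim : gcProjDim R C M < ⊤) (hM : HasFiniteProjectiveResolution R M) :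
    ∃ H : GCResolution R C M, H.IsProper ∧ MinimalityConditions C H.complex := by
  obtain ⟨d, hd⟩ := exists_gcDimLE hC.perp hdim
  obtain ⟨K₁, G₁, i₁, p₁, hs₁, hG₁, -, hK₁⟩ := exists_approximation hC d hM hd
  obtain ⟨K, G, i, p, hs, hG, hK, hno⟩ :=
    exists_minimal_approximation hC ⟨K₁, G₁, i₁, p₁, hs₁, hG₁, hK₁⟩
  -- Minimal presentations are chosen for all `C`-resolvable modules at once so that the tail arises
  -- by iteration; `succ` supplies the positive length they require.
  choose a L f q hfq hL hmin using
    fun A : {A : ModuleCat.{u} R // ∃ n, CResolvable R C n A} =>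
      A.2.choose_spec.succ.exists_minimal_presentation hC
  let it : ℕ → {A : ModuleCat.{u} R // ∃ n, CResolvable R C n A} := fun n =>
    Nat.rec ⟨K, _, hK⟩ (fun _ A => ⟨L A, _, hL A⟩) n
  let Z : ℕ → ModuleCat.{u} R
    | 0 => ModuleCat.of R M
    | n + 1 => (it n).1
  have key : ∀ n : ℕ, ∃ (X : ModuleCat.{u} R) (ι : Z (n + 1) →ₗ[R] X) (π : X →ₗ[R] Z n),
      ShortExactSeq ι π ∧ IsGCProjective C X ∧ (∃ m, CResolvable R C m (Z (n + 1))) ∧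
      (n = 0 → ¬ ContainsCSummand C (LinearMap.range ι)) ∧
      (1 ≤ n → (∃ α : ℕ, Nonempty (X ≃ₗ[R] (Fin α → C))) ∧
        ∀ x, ι x ∈ maximalIdeal R • (⊤ : Submodule R X)) := by
    rintro (_ | n)
    · exact ⟨G, i, p, hs, (isGCProjective_iff hC.perp G).2 hG, ⟨_, hK⟩, fun _ => hno,
        fun h => absurd h (by norm_num)⟩
    · exact ⟨ModuleCat.of R (Fin (a (it n)) → C), f (it n), q (it n), hfq (it n),
        (isGCProjective_iff hC.perp _).2 (gcClass_pow hC.perp _), (it (n + 1)).2,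
        fun h => absurd h (Nat.succ_ne_zero n), fun _ => ⟨⟨_, ⟨LinearEquiv.refl R _⟩⟩, hmin (it n)⟩⟩
  exact exists_proper_minimalityConditions_of_splice hC.perp Z key

end SpliceResolution

theorem isIso_of_isIso_comp_both {𝒞 : Type*} [Category 𝒞] {X Y : 𝒞} (f : X ⟶ Y) (g : Y ⟶ X)
    (h : IsIso (f ≫ g)) (h' : IsIso (g ≫ f)) : IsIso f := by
  have : Mono f := mono_of_mono f g
  have : IsSplitEpi f := IsSplitEpi.mk' ⟨inv (g ≫ f) ≫ g, by simp⟩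
  exact isIso_of_mono_of_isSplitEpi f

/-- `t⁻¹ • r` is a left inverse of `j`, so the range of `j` is a copy of `C` that splits off. -/
theorem containsCSummand_of_isUnit {R : Type u} [CommRing R] {C : Type u} [AddCommGroup C]
    [Module R C] {H : Type u} [AddCommGroup H] [Module R H] 
    {S : Submodule R H}
    (j : C →ₗ[R] H) (r : H →ₗ[R] C) {t : R} (ht : IsUnit t) (hrj : ∀ c, r (j c) = t • c)
    (hj : ∀ c, j c ∈ S) : ContainsCSummand C S := by
  obtain ⟨u, rfl⟩ := ht
  have hinv : ((↑u⁻¹ : R) • r) ∘ₗ j = LinearMap.id := LinearMap.ext fun c => by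
    simp [hrj, smul_smul]
  have hinj : Function.Injective j :=
    Function.LeftInverse.injective (g := (↑u⁻¹ : R) • r) (LinearMap.congr_fun hinv)
  refine ⟨LinearMap.range j, ?_, ⟨(LinearEquiv.ofInjective j hinj).symm⟩,
    _, LinearMap.isCompl_of_proj (f := j.rangeRestrict ∘ₗ ((↑u⁻¹ : R) • r)) ?_⟩
  swap
  · rintro ⟨_, c, rfl⟩
    exact Subtype.ext (congrArg j (LinearMap.congr_fun hinv c))
  rintro _ ⟨c, rfl⟩
  exact hj c

/-! ### The conditions imply minimality. -/

section Minimal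

variable {R : Type u} [CommRing R] [IsLocalRing R] {C : Type u} [AddCommGroup C] [Module R C]

/-- Nakayama gives surjectivity, and a surjective endomorphism of a finitely generated module is
injective. -/
theorem bijective_of_sub_mem_maximalIdeal_smul {N : Type u} [AddCommGroup N] [Module R N]
    [Module.Finite R N] (φ : N →ₗ[R] N)
    (hφ : ∀ x, φ x - x ∈ maximalIdeal R • (⊤ : Submodule R N)) : Function.Bijective φ := by
  have hs : Function.Surjective φ := by
    rw [← LinearMap.range_eq_top, ← top_le_iff]
    refine Submodule.le_of_le_smul_of_le_jacobson_bot Module.Finite.fg_top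
      (maximalIdeal_le_jacobson ⊥) fun x _ => ?_
    rw [← sub_sub_cancel (φ x) x]
    exact Submodule.sub_mem_sup ⟨x, rfl⟩ (hφ x)
  exact ⟨OrzechProperty.injective_of_surjective_endomorphism φ hs, hs⟩

/-- If a coordinate of `s ∘ d` were not valued in `𝔪C`, it would be a unit on some copy of `C`, and
`d` would carry that copy onto a direct summand of `H₀`. -/
theorem comp_mem_maximalIdeal_smul (hC : IsSemidualizing R C) {H H₀ : Type u} [AddCommGroup H]
    [Module R H] [AddCommGroup H₀] [Module R H₀] {a : ℕ} (e : H ≃ₗ[R] (Fin a → C))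
    (d : H →ₗ[R] H₀) (s : H₀ →ₗ[R] H) (hd : ¬ ContainsCSummand C (LinearMap.range d)) (x : H) :
    s (d x) ∈ maximalIdeal R • (⊤ : Submodule R H) := by
  have hres : CResolvable R C 1 (ModuleCat.of R (Fin a → C)) :=
    ⟨a, ModuleCat.of R PUnit.{u + 1}, 0, LinearMap.id,
      ⟨fun _ _ _ => rfl, fun x => ⟨fun hx => ⟨0, hx.symm⟩, by rintro ⟨_, rfl⟩; rfl⟩,
        Function.surjective_id⟩, inferInstanceAs (Subsingleton PUnit.{u + 1})⟩
  have h1 : e (s (d x)) ∈ maximalIdeal R • (⊤ : Submodule R (Fin a → C)) := by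
    refine mem_maximalIdeal_smul_pow fun i => ?_
    let r : H₀ →ₗ[R] C := LinearMap.proj i ∘ₗ e.toLinearMap ∘ₗ s
    rcases hres.surjective_or hC (r ∘ₗ d ∘ₗ e.symm.toLinearMap) with hsurj | hm
    · obtain ⟨j, t, ht, hjt⟩ := hC.exists_isUnit_of_surjective hsurj
      exact absurd (containsCSummand_of_isUnit
        (d ∘ₗ e.symm.toLinearMap ∘ₗ LinearMap.single R (fun _ => C) j) r ht hjt
        fun c => LinearMap.mem_range_self d _) hd
    · simpa [r] using hm (e x)
  have h2 := Submodule.mem_map_of_mem (f := e.symm.toLinearMap) h1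
  rw [Submodule.map_smul''] at h2
  simpa using Submodule.smul_mono le_rfl le_top h2

/-- In degrees `n ≥ 1` both terms of `e - 1 = sd + ds` land in `𝔪Hₙ`; for `sd` in degree 1 this is
the summand condition. `H₀` need not be finitely generated, so Nakayama is unavailable there. -/
theorem isIso_of_homotopy_id (hC : IsSemidualizing R C) {M : Type u} [AddCommGroup M] [Module R M]
    (H : GCResolution R C M) (hH : MinimalityConditions C H.complex)
    (e : H.complex ⟶ H.complex) (h : Homotopy e (𝟙 _)) : IsIso e := by
  have hcomm : ∀ i j x, (e.f j).hom ((H.complex.d i j).hom x) =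
      (H.complex.d i j).hom ((e.f i).hom x) := fun i j x =>
    (LinearMap.congr_fun (congrArg ModuleCat.Hom.hom (e.comm i j)) x).symm
  have hsucc : ∀ n x, (e.f (n + 1)).hom x - x =
      (h.hom n (n + 1)).hom ((H.complex.d (n + 1) n).hom x) +
      (H.complex.d (n + 2) (n + 1)).hom ((h.hom (n + 1) (n + 2)).hom x) := fun n x => by
    have := LinearMap.congr_fun (congrArg ModuleCat.Hom.hom (h.comm (n + 1))) x
    rw [Homotopy.dNext_succ_chainComplex, Homotopy.prevD_chainComplex] at this
    rw [sub_eq_iff_eq_add]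
    exact this
  have hzero : ∀ x, (e.f 0).hom x - x = (H.complex.d 1 0).hom ((h.hom 0 1).hom x) := fun x => by
    have := LinearMap.congr_fun (congrArg ModuleCat.Hom.hom (h.comm 0)) x
    rw [Homotopy.dNext_zero_chainComplex, Homotopy.prevD_chainComplex, zero_add] at this
    rw [sub_eq_iff_eq_add]
    exact this
  have hpos : ∀ n, Function.Bijective (e.f (n + 1)).hom := fun n => by
    obtain ⟨a, ⟨φ⟩⟩ := hH.free (n + 1) (Nat.le_add_left 1 n)
    have := hC.resolution.finite
    have : Module.Finite R (H.complex.X (n + 1)) := Module.Finite.equiv φ.symm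
    refine bijective_of_sub_mem_maximalIdeal_smul _ fun x => ?_
    rw [hsucc]
    refine Submodule.add_mem _ ?_ (hH.range_le (n + 2) (Nat.le_add_left 2 n) ⟨_, rfl⟩)
    cases n with
    | zero => exact comp_mem_maximalIdeal_smul hC φ _ _ hH.no_summand x
    | succ n =>
      have h1 := Submodule.mem_map_of_mem (f := (h.hom (n + 1) (n + 2)).hom)
        (hH.range_le (n + 2) (Nat.le_add_left 2 n) ⟨x, rfl⟩)
      rw [Submodule.map_smul''] at h1
      exact Submodule.smul_mono le_rfl le_top h1
  have haug : ∀ x, H.aug ((e.f 0).hom x) = H.aug x := fun x => by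
    rw [← sub_eq_zero, ← map_sub, hzero, H.exact_zero.apply_apply_eq_zero]
  -- A chase through `H₂ → H₁ → H₀ → M`: `e` preserves the augmentation and is bijective in degrees
  -- 1 and 2.
  have h0 : Function.Bijective (e.f 0).hom := by
    constructor
    · refine (injective_iff_map_eq_zero _).2 fun x hx => ?_
      have hx0 : H.aug x = 0 := by rw [← haug, hx, map_zero]
      obtain ⟨y, rfl⟩ := (H.exact_zero x).1 hx0
      rw [hcomm] at hx
      obtain ⟨z, hz⟩ := (H.exact_succ 0 _).1 hx
      obtain ⟨w, rfl⟩ := (hpos 1).2 z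
      rw [← hcomm] at hz
      rw [← (hpos 0).1 hz]
      exact (H.exact_succ 0).apply_apply_eq_zero w
    · intro x
      obtain ⟨y, hy⟩ := (H.exact_zero (x - (e.f 0).hom x)).1 (by rw [map_sub, haug, sub_self])
      obtain ⟨z, rfl⟩ := (hpos 0).2 y
      refine ⟨x + (H.complex.d 1 0).hom z, ?_⟩
      rw [map_add, hcomm, hy, add_sub_cancel]
  have : ∀ n, IsIso (e.f n) := fun n => by
    refine (ConcreteCategory.isIso_iff_bijective (e.f n)).2 ?_
    cases n with
    | zero => exact h0
    | succ n => exact hpos n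
  exact HomologicalComplex.Hom.isIso_of_components e

theorem MinimalityConditions.isMinimal (hC : IsSemidualizing R C) {M : Type u} [AddCommGroup M]
    [Module R M] (H : GCResolution R C M) (hH : MinimalityConditions C H.complex) :
    IsMinimal H.complex := fun f =>
  isIso_of_isIso_comp_both f.hom f.inv
    (isIso_of_homotopy_id hC H hH _ f.homotopyHomInvId)
    (isIso_of_homotopy_id hC H hH _ f.homotopyInvHomId)

end Minimal

/-! ### Comparison of proper resolutions up to homotopy. -/

section Comparison

variable {R : Type u} [CommRing R] {𝒳 : ModuleCat.{u} R → Prop} {M : Type u} [AddCommGroup M]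
  [Module R M]

namespace LeftResolution

theorem IsProper.exists_lift_aug {X : LeftResolution 𝒳 M} (hX : X.IsProper) {Y : ModuleCat.{u} R}
    (hY : 𝒳 Y) (φ : Y →ₗ[R] M) : ∃ ψ : Y ⟶ X.complex.X 0, X.aug ∘ₗ ψ.hom = φ := by
  obtain ⟨ψ, hψ⟩ := (hX Y hY).1 φ
  exact ⟨ModuleCat.ofHom ψ, hψ⟩

theorem IsProper.exists_lift_zero {X : LeftResolution 𝒳 M} (hX : X.IsProper) {Y : ModuleCat.{u} R}
    (hY : 𝒳 Y) (φ : Y ⟶ X.complex.X 0) (hφ : X.aug ∘ₗ φ.hom = 0) :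
    ∃ ψ : Y ⟶ X.complex.X 1, ψ ≫ X.complex.d 1 0 = φ := by
  obtain ⟨ψ, hψ⟩ := ((hX Y hY).2.1 φ.hom).1 hφ
  exact ⟨ModuleCat.ofHom ψ, ModuleCat.hom_ext hψ⟩

theorem IsProper.exists_lift_succ {X : LeftResolution 𝒳 M} (hX : X.IsProper) {Y : ModuleCat.{u} R}
    (hY : 𝒳 Y) (n : ℕ) (φ : Y ⟶ X.complex.X (n + 1)) (hφ : φ ≫ X.complex.d (n + 1) n = 0) :
    ∃ ψ : Y ⟶ X.complex.X (n + 2), ψ ≫ X.complex.d (n + 2) (n + 1) = φ := by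
  obtain ⟨ψ, hψ⟩ := ((hX Y hY).2.2 n φ.hom).1 (congrArg ModuleCat.Hom.hom hφ)
  exact ⟨ModuleCat.ofHom ψ, ModuleCat.hom_ext hψ⟩

/-- The identity of `M` lifts to a morphism from any resolution to a proper one. -/
theorem IsProper.exists_hom (X : LeftResolution 𝒳 M) {X' : LeftResolution 𝒳 M}
    (hX' : X'.IsProper) :
    ∃ f : X.complex ⟶ X'.complex, X'.aug ∘ₗ (f.f 0).hom = X.aug := by
  obtain ⟨f₀, hf₀⟩ := hX'.exists_lift_aug (X.mem 0) X.aug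
  obtain ⟨f₁, hf₁⟩ := hX'.exists_lift_zero (X.mem 1) (X.complex.d 1 0 ≫ f₀) (by
    rw [ModuleCat.hom_comp, ← LinearMap.comp_assoc, hf₀]
    exact X.exact_zero.linearMap_comp_eq_zero)
  exact ⟨ChainComplex.mkHom _ _ f₀ f₁ hf₁ fun n p =>
    have h := hX'.exists_lift_succ (X.mem (n + 2)) n (X.complex.d (n + 2) (n + 1) ≫ p.2.1) (by
      rw [Category.assoc, p.2.2, ← Category.assoc, X.complex.d_comp_d, Limits.zero_comp])
    ⟨h.choose, h.choose_spec⟩, hf₀⟩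

/-- A morphism to a proper resolution that lifts the zero map is null-homotopic. -/
theorem IsProper.nonempty_homotopy_zero {X X' : LeftResolution 𝒳 M} (hX' : X'.IsProper)
    (e : X.complex ⟶ X'.complex) (he : X'.aug ∘ₗ (e.f 0).hom = 0) : Nonempty (Homotopy e 0) := by
  obtain ⟨s₀, hs₀⟩ := hX'.exists_lift_zero (X.mem 0) (e.f 0) he
  obtain ⟨s₁, hs₁⟩ := hX'.exists_lift_succ (X.mem 1) 0 (e.f 1 - X.complex.d 1 0 ≫ s₀) (by
    rw [Preadditive.sub_comp, Category.assoc, hs₀, e.comm, sub_self])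
  exact ⟨Homotopy.mkInductive e s₀ hs₀.symm s₁ (by rw [hs₁, add_sub_cancel]) fun n p =>
    have h := hX'.exists_lift_succ (X.mem (n + 2)) (n + 1)
      (e.f (n + 2) - X.complex.d (n + 2) (n + 1) ≫ p.2.1) (by
        have h1 : p.2.1 ≫ X'.complex.d (n + 2) (n + 1) =
            e.f (n + 1) - X.complex.d (n + 1) n ≫ p.1 := eq_sub_of_add_eq' p.2.2.symm
        rw [Preadditive.sub_comp, Category.assoc, h1, e.comm, Preadditive.comp_sub,
          ← Category.assoc, X.complex.d_comp_d, Limits.zero_comp, sub_zero, sub_self])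
    ⟨h.choose, by rw [h.choose_spec, add_sub_cancel]⟩⟩

theorem IsProper.nonempty_homotopy_id {X : LeftResolution 𝒳 M} (hX : X.IsProper)
    (e : X.complex ⟶ X.complex) (he : X.aug ∘ₗ (e.f 0).hom = X.aug) :
    Nonempty (Homotopy e (𝟙 _)) := by
  obtain ⟨h⟩ := hX.nonempty_homotopy_zero (e - 𝟙 _) (by
    rw [HomologicalComplex.sub_f_apply, ModuleCat.hom_sub, LinearMap.comp_sub, he]
    exact sub_self _)
  exact ⟨Homotopy.equivSubZero.symm h⟩

theorem IsProper.nonempty_homotopyEquiv {X X' : LeftResolution 𝒳 M} (hX : X.IsProper)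
    (hX' : X'.IsProper) : Nonempty (HomotopyEquiv X.complex X'.complex) := by
  obtain ⟨f, hf⟩ := hX'.exists_hom X
  obtain ⟨g, hg⟩ := hX.exists_hom X'
  obtain ⟨h⟩ := hX.nonempty_homotopy_id (f ≫ g) (by
    rw [HomologicalComplex.comp_f, ModuleCat.hom_comp, ← LinearMap.comp_assoc, hg, hf])
  obtain ⟨h'⟩ := hX'.nonempty_homotopy_id (g ≫ f) (by
    rw [HomologicalComplex.comp_f, ModuleCat.hom_comp, ← LinearMap.comp_assoc, hf, hg])
  exact ⟨⟨f, g, h, h'⟩⟩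

/-- Minimal proper resolutions are unique up to isomorphism. -/
theorem IsProper.nonempty_iso {X X' : LeftResolution 𝒳 M} (hX : X.IsProper) (hX' : X'.IsProper)
    (hm : IsMinimal X.complex) (hm' : IsMinimal X'.complex) :
    Nonempty (X.complex ≅ X'.complex) := by
  obtain ⟨f⟩ := hX.nonempty_homotopyEquiv hX'
  have := isIso_of_isIso_comp_both f.hom f.inv (hm (f.trans f.symm)) (hm' (f.symm.trans f))
  exact ⟨asIso f.hom⟩

end LeftResolution

end Comparison

/-! ### Invariance of the minimality conditions under isomorphism. -/

section Transport

variable {R : Type u} [CommRing R] {C : Type u} [AddCommGroup C] [Module R C]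

theorem ContainsCSummand.map {H H' : Type u} [AddCommGroup H] [Module R H] [AddCommGroup H']
    [Module R H'] {S : Submodule R H} {S' : Submodule R H'} (h : ContainsCSummand C S)
    (e : H ≃ₗ[R] H') (he : ∀ x ∈ S, e x ∈ S') : ContainsCSummand C S' := by
  obtain ⟨N, hN, ⟨t⟩, N', hc⟩ := h
  refine ⟨N.map e.toLinearMap, ?_, ⟨(e.submoduleMap N).symm.trans t⟩, N'.map e.toLinearMap,
    (Submodule.orderIsoMapComap e).isCompl hc⟩
  rintro _ ⟨x, hx, rfl⟩
  exact he x (hN hx)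

theorem MinimalityConditions.of_iso [IsLocalRing R] {H H' : ChainComplex (ModuleCat.{u} R) ℕ}
    (h : MinimalityConditions C H) (φ : H ≅ H') : MinimalityConditions C H' := by
  let e : ∀ n, H.X n ≃ₗ[R] H'.X n := fun n =>
    ((HomologicalComplex.eval _ _ n).mapIso φ).toLinearEquiv
  have he : ∀ i j x, e j ((H.d i j).hom x) = (H'.d i j).hom (e i x) := fun i j x =>
    (LinearMap.congr_fun (congrArg ModuleCat.Hom.hom (φ.hom.comm i j)) x).symm
  refine ⟨fun n hn => ?_, fun n hn => ?_, fun hS => h.no_summand (hS.map (e 0).symm ?_)⟩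
  · obtain ⟨α, ⟨t⟩⟩ := h.free n hn
    exact ⟨α, ⟨(e n).symm.trans t⟩⟩
  · rintro _ ⟨y, rfl⟩
    obtain ⟨x, rfl⟩ := (e n).surjective y
    rw [← he]
    have h1 := Submodule.mem_map_of_mem (f := (e (n - 1)).toLinearMap)
      (h.range_le n hn ⟨x, rfl⟩)
    rw [Submodule.map_smul''] at h1
    exact Submodule.smul_mono le_rfl le_top h1
  · rintro _ ⟨y, rfl⟩
    obtain ⟨x, rfl⟩ := (e 1).surjective y
    rw [← he, LinearEquiv.symm_apply_apply]
    exact LinearMap.mem_range_self _ _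

end Transport

end GCProj

theorem proposition4p9 {R : Type u} [CommRing R] [IsLocalRing R]
    (C : Type u) [AddCommGroup C] [Module R C] (hC : GCProj.IsSemidualizing R C)
    (M : Type u) [AddCommGroup M] [Module R M] [Module.Finite R M]
    (hdim : GCProj.gcProjDim R C M < ⊤)
    (hM : GCProj.HasFiniteProjectiveResolution R M)
    (hMC : GCProj.HasFiniteProjectiveResolution R (M →ₗ[R] C)) :
    (∃ H : GCProj.GCResolution R C M, H.IsProper ∧ GCProj.IsMinimal H.complex) ∧
    (∀ H : GCProj.GCResolution R C M, H.IsProper →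
      (GCProj.IsMinimal H.complex ↔ GCProj.MinimalityConditions C H.complex)) ∧
    (∀ H : GCProj.GCResolution R C M,
      GCProj.MinimalityConditions C H.complex → GCProj.IsMinimal H.complex) := by
  obtain ⟨H₀, hp₀, hc₀⟩ := GCProj.exists_proper_minimalityConditions hC hdim hM
  have hm₀ := hc₀.isMinimal hC
  refine ⟨⟨H₀, hp₀, hm₀⟩, fun H hp => ⟨fun hm => ?_, fun h => h.isMinimal hC H⟩,
    fun H h => h.isMinimal hC H⟩
  -- Uniqueness of minimal proper resolutions reduces the forward implication to the constructed
  -- `H₀`.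
  obtain ⟨φ⟩ := hp₀.nonempty_iso hp hm₀ hm
  exact hc₀.of_iso φ
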